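/- **Setting.** Let $\epsilon_0,\mu_0,\tau_0,\sigma_0,T>0$, $C_v=1/\sqrt{\epsilon_0\mu_0}$, let $r\ge 1$ be an integer, let $\Omega\subset\mathbb R^2$ be a bounded polygonal domain and $\Gamma$ a (polygonal) sheet in $\overline\Omega$. Write $\nabla\times u=\partial_x u_y-\partial_y u_x$, $a\times n=a_xn_y-a_yn_x$; $(\cdot,\cdot)$ and $\|\cdot\|$ are the $L^2(\Omega)$ inner product and norm, $\langle u,v\rangle_\Gamma=\int_\Gamma (u\times n)(v\times n)\,ds$ with $n$ a unit normal of $\Gamma$, and $\|v\|_\Gamma=\langle v,v\rangle_\Gamma^{1/2}$. Let $\mathcal T_h$ be a conforming triangulation of $\Omega$ with maximal triangle diameter $h$, such that $\Gamma$ is a union of interior edges. Let $p_k$ be the polynomials of degree at most $k$, $\tilde p_k$ the homogeneous polynomials of degree $k$, $S_r=\{s\in\tilde p_r^{\,2}: x\cdot s=0\}$, and $$U_h=\{u\in L^2(\Omega): u|_K\in p_{r-1}\ \forall K\in\mathcal T_h\},\qquad V_h=\{v\in H(\mathrm{curl};\Omega): v|_K\in (p_{r-1})^2\oplus S_r\ \forall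 K\in\mathcal T_h\},$$ and let $V_h^0$ be the set of $v\in V_h$ with $\hat\nu\times v=0$ on $\partial\Omega$, where $\hat\nu$ is the unit outward normal. Positive numbers $C_{\rm in},C_{\rm tr}$ are called *admissible* for $\mathcal T_h$ if $$\|\nabla\times\phi\|\le C_{\rm in}h^{-1}\|\phi\|,\qquad \|\phi\|_\Gamma\le C_{\rm tr}h^{-1/2}\|\phi\|\qquad\text{for all }\phi\in V_h .$$ **Scheme.** Let $\tau=T/N_t$ with an integer $N_t\ge1$, let $K_s(\cdot,t)\in L^2(\Omega)$ for $t\in[0,T]$, and $K_s^n=K_s(\cdot,n\tau)$. For a sequence $u$ put $$\delta_\tau u^n=\frac{u^{n+1/2}-u^{n-1/2}}{\tau},\quad \delta_{2\tau}u^n=\frac{u^{n+1}-u^{n-1}}{2\tau},\quad \delta_\tau^2u^n=\frac{u^{n+1}-2u^n+u^{n-1}}{\tau^2},\quad \overline u^n=\frac{u^{n+1/2}+u^{n-1/2}}{2}.$$ Let $E_h^{-1}\in V_h$, $E_h^n\in V_h^0$ $(0\le n\le N_t)$ and $H_h^{n+1/2}\in U_h$ $(-1\le n\le N_t-1)$ satisfy,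 for all $0\le n\le N_t-1$, $\phi_h\in V_h^0$, $\psi_h\in U_h$, $$\epsilon_0(\delta_\tau^2E_h^n,\phi_h)+\frac{\epsilon_0}{\tau_0}(\delta_{2\tau}E_h^n,\phi_h)+\frac1{\mu_0}(\nabla\times E_h^n,\nabla\times\phi_h)=\frac1{\tau_0}(\overline H_h^n,\nabla\times\phi_h)-\frac{\sigma_0}{\tau_0}\langle E_h^n,\phi_h\rangle_\Gamma-\frac1{\mu_0}(K_s^n,\nabla\times\phi_h),$$ $$\mu_0(\delta_\tau H_h^n,\psi_h)=-(\nabla\times E_h^n,\psi_h)-(K_s^n,\psi_h).$$ Define $$\begin{aligned}ENG_m={}&\epsilon_0\|\delta_\tau E_h^{m+1/2}\|^2+\frac1{2\mu_0}\left(\|\nabla\times E_h^{m+1}\|^2+\|\nabla\times E_h^m\|^2\right)+\mu_0\|H_h^{m+1/2}\|^2\\&+\frac{\sigma_0}{2\tau_0}\left(\|E_h^{m+1}\|_\Gamma^2+\|E_h^m\|_\Gamma^2\right)+\frac{\tau}{4\mu_0\tau_0}\left(\|\nabla\times E_h^{m+1}\|^2+\|\nabla\times E_h^m\|^2\right).\end{aligned}$$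 **Theorem.** (a) For every $\kappa>0$ there are constants $C_{\rm in},C_{\rm tr}>0$ that are admissible for every such triangulation in which each triangle contains a disc of radius $h/\kappa$. (b) For all $C_{\rm in},C_{\rm tr}>0$ there is a constant $C_*>0$, depending only on $\epsilon_0,\mu_0,\tau_0,\sigma_0,T,r,\Omega,\Gamma,C_{\rm in},C_{\rm tr}$ (in particular independent of $\tau$ and $h$), such that for every triangulation for which $C_{\rm in},C_{\rm tr}$ are admissible, every $\tau=T/N_t$ with $$\tau\le\min\left(1,\ \frac{h}{2C_{\rm in}C_v},\ \frac{h\sqrt{\epsilon_0\tau_0}}{2C_{\rm tr}\sqrt{\sigma_0}},\ \frac{h\sqrt{\tau_0}}{\sqrt2\,C_{\rm in}C_v},\ \frac{h\tau_0}{C_{\rm in}C_v}\right),$$ every source $K_s$ and every solution of the scheme, one has for all $1\le m\le N_t-1$ $$ENG_m\le C_*\left[ENG_0+\|K_s^0\|^2+\|K_s^1\|^2+\tau\sum_{n=1}^m\left(\|K_s^n\|^2+\|\delta_{2\tau}K_s^n\|^2\right)\right].$$ -/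

import Mathlib

open MeasureTheory
open scoped ContDiff

noncomputable section

namespace Graphene

/-- The Euclidean plane. -/
abbrev Plane : Type := EuclideanSpace ℝ (Fin 2)

/-- Polynomials in the two coordinates. -/
abbrev Poly : Type := MvPolynomial (Fin 2) ℝ

/-- Value of a polynomial at a point of the plane. -/
def evalAt (x : Plane) (p : Poly) : ℝ := MvPolynomial.eval (fun i => x i) p

/-- The (positive) physical constants: permittivity, permeability, relaxation time and
surface conductivity of the graphene sheet. -/
structure Params where
  ε₀ : ℝ
  μ₀ : ℝ
  τ₀ : ℝ
  σ₀ : ℝ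
  ε₀_pos : 0 < ε₀
  μ₀_pos : 0 < μ₀
  τ₀_pos : 0 < τ₀
  σ₀_pos : 0 < σ₀

/-- The wave propagation speed. -/
def Params.Cv (p : Params) : ℝ := 1 / √(p.ε₀ * p.μ₀)

/-! ### Inner products, norms and the weak curl on `Ω` -/

/-- `L²(Ω)` inner product of scalar functions. -/
def ip (Ω : Set Plane) (f g : Plane → ℝ) : ℝ := ∫ x in Ω, f x * g x

/-- `L²(Ω)` inner product of vector fields. -/
def ipV (Ω : Set Plane) (f g : Plane → Fin 2 → ℝ) : ℝ := ∫ x in Ω, ∑ i, f x i * g x i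

/-- `L²(Ω)` norm of a scalar function. -/
def nrm (Ω : Set Plane) (f : Plane → ℝ) : ℝ := √(ip Ω f f)

/-- `L²(Ω)` norm of a vector field. -/
def nrmV (Ω : Set Plane) (f : Plane → Fin 2 → ℝ) : ℝ := √(ipV Ω f f)

/-- Partial derivative of a scalar function. -/
def pd (i : Fin 2) (φ : Plane → ℝ) (x : Plane) : ℝ :=
  fderiv ℝ φ x (EuclideanSpace.single i 1)

/-- `u ∈ H(curl; Ω)`, with weak curl `w = ∂ₓ u_y - ∂_y u_x ∈ L²(Ω)`: both are square integrable and
`∫_Ω u · (∂_y φ, -∂ₓ φ) = ∫_Ω w φ` for all test functions `φ ∈ C_c^∞(Ω)`. -/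
structure HasWeakCurl (Ω : Set Plane) (u : Plane → Fin 2 → ℝ) (w : Plane → ℝ) : Prop where
  memLp_field : ∀ i, MemLp (fun x => u x i) 2 (volume.restrict Ω)
  memLp_curl : MemLp w 2 (volume.restrict Ω)
  integral_eq : ∀ φ : Plane → ℝ, ContDiff ℝ ∞ φ → HasCompactSupport φ → tsupport φ ⊆ Ω →
    ∫ x in Ω, (u x 0 * pd 1 φ x - u x 1 * pd 0 φ x) = ∫ x in Ω, w x * φ x

/-! ### Triangulations -/

/-- The closed triangle, or the closed edge, spanned by a finite set of vertices. -/
def hull (s : Finset Plane) : Set Plane := convexHull ℝ (s : Set Plane)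

/-- A conforming triangulation of the polygonal set `Ω` which has the sheet `Γ` as an internal
boundary. A triangle is given by its set of vertices; an edge is a two-element subset of it. -/
structure TriMesh (Ω Γ : Set Plane) where
  triangles : Finset (Finset Plane)
  card_eq : ∀ t ∈ triangles, t.card = 3
  /-- the triangles are nondegenerate -/
  indep : ∀ t ∈ triangles, AffineIndependent ℝ (fun v : t => (v : Plane))
  /-- two triangles meet in their common vertices, their common edge, or not at all -/
  conforming : ∀ s ∈ triangles, ∀ t ∈ triangles,
    hull s ∩ hull t = convexHull ℝ ((s : Set Plane) ∩ (t : Set Plane))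
  cover : ⋃ t ∈ triangles, hull t = closure Ω
  interior_subset : ∀ t ∈ triangles, interior (hull t) ⊆ Ω
  /-- each edge lies on the boundary of `Ω`, or has its relative interior inside `Ω` -/
  edge_cases : ∀ t ∈ triangles, ∀ e ∈ t.powersetCard 2,
    hull e ⊆ frontier Ω ∨ hull e \ (e : Set Plane) ⊆ Ω
  /-- every point of the sheet lies on an edge that is part of the sheet -/
  sheet_cover : ∀ x ∈ Γ, ∃ t ∈ triangles, ∃ e ∈ t.powersetCard 2, x ∈ hull e ∧ hull e ⊆ Γ
  /-- the edges that form the sheet are interior edges -/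
  sheet_interior : ∀ t ∈ triangles, ∀ e ∈ t.powersetCard 2,
    hull e ⊆ Γ → hull e \ (e : Set Plane) ⊆ Ω

namespace TriMesh

variable {Ω Γ : Set Plane} (M : TriMesh Ω Γ)

/-- The maximum mesh size `h`. -/
def h : ℝ := ⨆ t : M.triangles, Metric.diam (hull t)

open Classical in
/-- The edges that make up the sheet `Γ`. -/
def sheetEdges : Finset (Finset Plane) :=
  (M.triangles.biUnion fun t => t.powersetCard 2).filter fun e => hull e ⊆ Γ

/-- Shape regular and quasi-uniform with constant `κ`: every triangle contains a disc of
radius `h / κ`. -/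
def QuasiUniform (κ : ℝ) : Prop :=
  ∀ t ∈ M.triangles, ∃ c : Plane, Metric.ball c (M.h / κ) ⊆ hull t

/-! ### Piecewise polynomial fields and the Raviart–Thomas–Nédélec spaces -/

/-- Piecewise polynomial scalar functions: one polynomial for each triangle. -/
abbrev PScalar : Type := M.triangles → Poly

/-- Piecewise polynomial vector fields. -/
abbrev PVector : Type := M.triangles → Fin 2 → Poly

/-- The function on the plane given by a piecewise polynomial (it is set to zero on the edges and
outside the triangles). -/
def fn (u : M.PScalar) (x : Plane) : ℝ :=
  ∑ t : M.triangles, (interior (hull t)).indicator (fun y => evalAt y (u t)) x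

/-- The vector field on the plane given by a piecewise polynomial vector field. -/
def fnV (v : M.PVector) (x : Plane) (i : Fin 2) : ℝ := M.fn (fun t => v t i) x

/-- The curl `∂ₓ v_y - ∂_y v_x`, triangle by triangle. -/
def curl (v : M.PVector) : M.PScalar :=
  fun t => MvPolynomial.pderiv 0 (v t 1) - MvPolynomial.pderiv 1 (v t 0)

end TriMesh

/-- The local space `(p_{r-1})² ⊕ S_r`, where `S_r` consists of the `s` in `(p̃_r)²`
with `x · s = 0`. -/
def nedelec (r : ℕ) : Set (Fin 2 → Poly) :=
  {p | ∃ q s : Fin 2 → Poly, p = q + s ∧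
    (∀ i, q i ∈ MvPolynomial.restrictTotalDegree (Fin 2) ℝ (r - 1)) ∧
    (∀ i, s i ∈ MvPolynomial.homogeneousSubmodule (Fin 2) ℝ r) ∧
    MvPolynomial.X 0 * s 0 + MvPolynomial.X 1 * s 1 = 0}

/-- A unit normal vector of an edge (its sign plays no role below). -/
def edgeNormal (e : Finset Plane) : Plane :=
  Classical.epsilon fun n => ‖n‖ = 1 ∧ ∀ a ∈ e, ∀ b ∈ e, inner ℝ n (b - a) = 0

/-- The planar cross product `a × n = a_x n_y - a_y n_x`. -/
def cross (a : Fin 2 → ℝ) (n : Plane) : ℝ := a 0 * n 1 - a 1 * n 0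

namespace TriMesh

variable {Ω Γ : Set Plane} (M : TriMesh Ω Γ)

/-- `U_h`: discontinuous piecewise polynomials of degree at most `r - 1`. -/
def U (r : ℕ) : Set M.PScalar :=
  {u | ∀ t, u t ∈ MvPolynomial.restrictTotalDegree (Fin 2) ℝ (r - 1)}

/-- `V_h`: the fields in `H(curl; Ω)` that are in `(p_{r-1})² ⊕ S_r` on each triangle. The weak
curl of a piecewise polynomial field in `H(curl; Ω)` is necessarily its piecewise curl, so the
weak curl is named here explicitly. -/
def V (r : ℕ) : Set M.PVector :=
  {v | (∀ t, v t ∈ nedelec r) ∧ HasWeakCurl Ω (M.fnV v) (M.fn (M.curl v))}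

/-- `V_h⁰`: the fields in `V_h` whose tangential trace vanishes on the boundary of `Ω`. -/
def V₀ (r : ℕ) : Set M.PVector :=
  {v | v ∈ M.V r ∧ ∀ t : M.triangles, ∀ e ∈ (t : Finset Plane).powersetCard 2,
    hull e ⊆ frontier Ω → ∀ x ∈ hull e, cross (fun i => evalAt x (v t i)) (edgeNormal e) = 0}

open Classical in
/-- The trace of a piecewise polynomial field on an edge: the mean of the traces from the
adjacent triangles. For a field in `H(curl; Ω)` and an interior edge the tangential components of
these traces coincide, so that the tangential component of the mean is the tangential trace. -/
def edgeTrace (v : M.PVector) (e : Finset Plane) (x : Plane) (i : Fin 2) : ℝ :=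
  (∑ t : M.triangles, if e ⊆ (t : Finset Plane) then evalAt x (v t i) else 0) /
    (M.triangles.filter fun t => e ⊆ t).card

/-- `⟨u, v⟩_Γ = ∫_Γ (u × n) (v × n) ds`. -/
def sheetIp (u v : M.PVector) : ℝ :=
  ∑ e ∈ M.sheetEdges, ∫ x in hull e,
    cross (M.edgeTrace u e x) (edgeNormal e) * cross (M.edgeTrace v e x) (edgeNormal e)
      ∂(Measure.hausdorffMeasure 1)

/-- `‖v‖_Γ = (∫_Γ |v × n|² ds)^{1/2}`. -/
def sheetNrm (v : M.PVector) : ℝ := √(M.sheetIp v v)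

/-- `‖∇ × φ‖ ≤ C h⁻¹ ‖φ‖` for all `φ ∈ V_h`. -/
def InverseEstimate (r : ℕ) (C : ℝ) : Prop :=
  ∀ φ ∈ M.V r, nrm Ω (M.fn (M.curl φ)) ≤ C * M.h⁻¹ * nrmV Ω (M.fnV φ)

/-- `‖φ‖_Γ ≤ C h^{-1/2} ‖φ‖` for all `φ ∈ V_h`. -/
def TraceInequality (r : ℕ) (C : ℝ) : Prop :=
  ∀ φ ∈ M.V r, M.sheetNrm φ ≤ C * (√M.h)⁻¹ * nrmV Ω (M.fnV φ)

/-! ### The leapfrog scheme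

A sequence `E : ℤ → _` holds the `E_h^n`; a sequence `H : ℤ → _` holds the values at half-integers,
`H n = H_h^{n + 1/2}`. The source at the time `n τ` is `Ks (n τ)`. -/

/-- `E` and `H` solve the leapfrog scheme with `N` steps of size `τ` and the source `Ks`, started
from arbitrary `E_h^{-1}`, `E_h^0` and `H_h^{-1/2}`. -/
structure IsLeapfrog (p : Params) (r N : ℕ) (τ : ℝ) (Ks : ℝ → Plane → ℝ)
    (E : ℤ → M.PVector) (H : ℤ → M.PScalar) : Prop where
  E_start : E (-1) ∈ M.V r
  E_mem : ∀ n : ℤ, 0 ≤ n → n ≤ N → E n ∈ M.V₀ r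
  H_mem : ∀ n : ℤ, -1 ≤ n → n ≤ (N : ℤ) - 1 → H n ∈ M.U r
  E_step : ∀ n : ℤ, 0 ≤ n → n ≤ (N : ℤ) - 1 → ∀ φ ∈ M.V₀ r,
    p.ε₀ * ipV Ω (M.fnV ((τ ^ 2)⁻¹ • (E (n + 1) - (2 : ℝ) • E n + E (n - 1)))) (M.fnV φ)
      + p.ε₀ / p.τ₀ * ipV Ω (M.fnV ((2 * τ)⁻¹ • (E (n + 1) - E (n - 1)))) (M.fnV φ)
      + 1 / p.μ₀ * ip Ω (M.fn (M.curl (E n))) (M.fn (M.curl φ))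
    = 1 / p.τ₀ * ip Ω (M.fn ((2 : ℝ)⁻¹ • (H n + H (n - 1)))) (M.fn (M.curl φ))
      - p.σ₀ / p.τ₀ * M.sheetIp (E n) φ
      - 1 / p.μ₀ * ip Ω (Ks (n * τ)) (M.fn (M.curl φ))
  H_step : ∀ n : ℤ, 0 ≤ n → n ≤ (N : ℤ) - 1 → ∀ ψ ∈ M.U r,
    p.μ₀ * ip Ω (M.fn (τ⁻¹ • (H n - H (n - 1)))) (M.fn ψ)
    = - ip Ω (M.fn (M.curl (E n))) (M.fn ψ) - ip Ω (Ks (n * τ)) (M.fn ψ)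

/-- The discrete energy `ENG_m`. -/
def energy (p : Params) (τ : ℝ) (E : ℤ → M.PVector) (H : ℤ → M.PScalar) (m : ℤ) : ℝ :=
  p.ε₀ * nrmV Ω (M.fnV (τ⁻¹ • (E (m + 1) - E m))) ^ 2
  + 1 / (2 * p.μ₀) *
      (nrm Ω (M.fn (M.curl (E (m + 1)))) ^ 2 + nrm Ω (M.fn (M.curl (E m))) ^ 2)
  + p.μ₀ * nrm Ω (M.fn (H m)) ^ 2
  + p.σ₀ / (2 * p.τ₀) * (M.sheetNrm (E (m + 1)) ^ 2 + M.sheetNrm (E m) ^ 2)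
  + τ / (4 * p.μ₀ * p.τ₀) *
      (nrm Ω (M.fn (M.curl (E (m + 1)))) ^ 2 + nrm Ω (M.fn (M.curl (E m))) ^ 2)

end TriMesh

/-- The time step constraint. -/
def CFL (p : Params) (Cin Ctr h τ : ℝ) : Prop :=
  τ ≤ min 1 (min (h / (2 * Cin * p.Cv)) (min (h * √(p.ε₀ * p.τ₀) / (2 * Ctr * √p.σ₀))
    (min (h * √p.τ₀ / (√2 * Cin * p.Cv)) (h * p.τ₀ / (Cin * p.Cv)))))

end Graphene

end

open MeasureTheory
open scoped ContDiff

noncomputable section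

namespace Graphene

/-! ### Discrete Gronwall inequality -/

/-! Stability is a discrete energy argument. Test the field equation with E^{n+1} - E^{n-1}. The
inertial, curl and sheet terms telescope, and the damping term has a sign. The magnetic field and
the source are paired with the curl of E^{n+1} - E^{n-1}, a difference over two steps, so both are
summed by parts in time. Moving the resulting boundary terms into the energy gives `corrected`,
whose growth per step is τ times quantities bounded by the energy and the sources
(`corrected_step`).

The corrected energy contains the mixed products (curl E^{n+1}, curl E^n) and ⟨E^{n+1}, E^n⟩_Γ
instead of squares. By polarisation these are half the sum of the squares minus half the square of
the difference. The difference is τ δ_τ E, so the inverse and trace estimates absorb it into the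
kinetic term when τ is small (`eng_le_corrected`). The remaining magnetic contribution is not
absorbed. The magnetic equation, tested with its own increment, bounds it by the accumulated energy
(`magnetic_bound`). Together these yield x_j ≤ C (F + τ Σ_{i<j} x_i) for the energies x_j, with F
the data, and Gronwall finishes.

One gap has to be closed. The trace estimate scales like h^{-1/2}, so absorption of the sheet term
needs τ² ≲ h, whereas the time step restriction gives τ² ≲ h². This is enough for h ≤ 1. If
absorption fails, then h ≥ 1 and τ is bounded below by a fixed t (`lower_bounds_of_large_step`). A
crude bound for a single step then suffices (`eng_succ_le`), because the previous energy is at most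
t⁻¹ times its own term τ x_n in the Gronwall sum.

The admissible constants come from equivalence of norms on polynomials of bounded degree. A triangle
lies between a disc of radius h/κ and the concentric disc of radius h; rescaling these to fixed
discs replaces the usual reference triangle and gives pointwise bounds uniform in the shape
(`exists_sq_evalAt_le_scaled`). Integration over triangles and over edges gives the two estimates.

The energy argument is carried out for abstract forms A, S and a linear map L, so that its constant
is visibly independent of the mesh. -/

theorem gronwall_sum {C F τ T : ℝ} (hC : 0 ≤ C) (hF : 0 ≤ F) (hτ : 0 ≤ τ) {M : ℕ}
    (hM : M * τ ≤ T) {x : ℕ → ℝ}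
    (hx : ∀ j ≤ M, x j ≤ C * (F + τ * ∑ i ∈ Finset.range j, x i)) :
    x M ≤ C * Real.exp (C * T) * F := by
  -- The sum stops before j, so the right-hand side grows by a factor of at most 1 + Cτ per step,
  -- and no smallness of τ is needed.
  have key : ∀ j ≤ M, F + τ * ∑ i ∈ Finset.range j, x i ≤ F * (1 + C * τ) ^ j := by
    intro j
    induction j with
    | zero => intro _; simp
    | succ j ih =>
      intro hj
      have h1 := ih (by omega)
      have h2 := mul_le_mul_of_nonneg_left (hx j (by omega)) hτ
      have h3 : (1 + C * τ) * (F + τ * ∑ i ∈ Finset.range j, x i)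
          ≤ (1 + C * τ) * (F * (1 + C * τ) ^ j) :=
        mul_le_mul_of_nonneg_left h1 (by positivity)
      rw [Finset.sum_range_succ, pow_succ]
      linarith
  have h1 : (1 + C * τ) ^ M ≤ Real.exp (C * T) := by
    calc (1 + C * τ) ^ M ≤ Real.exp (C * τ) ^ M := by
          gcongr
          linarith [Real.add_one_le_exp (C * τ)]
      _ = Real.exp (C * (M * τ)) := by rw [← Real.exp_nat_mul]; ring_nf
      _ ≤ _ := by gcongr
  calc x M ≤ C * (F * (1 + C * τ) ^ M) :=
        (hx M le_rfl).trans (mul_le_mul_of_nonneg_left (key M le_rfl) hC)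
    _ ≤ C * (F * Real.exp (C * T)) := by gcongr
    _ = _ := by ring

/-- A sequence with increments bounded by `τ`-weighted terms is bounded by their sum. -/
theorem le_add_sum_of_step {τ : ℝ} {y z : ℕ → ℝ} {M : ℕ}
    (h : ∀ n < M, y (n + 1) ≤ y n + τ * z n) :
    ∀ j ≤ M, y j ≤ y 0 + τ * ∑ i ∈ Finset.range j, z i := by
  intro j
  induction j with
  | zero => intro _; simp
  | succ j ih =>
    intro hj
    have := ih (by omega)
    have := h j (by omega)
    rw [Finset.sum_range_succ]
    linarith

/-! ### Elementary inequalities for bilinear forms and inner products -/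

section Forms

variable {W Y : Type*} [AddCommGroup W] [Module ℝ W] [NormedAddCommGroup Y] [InnerProductSpace ℝ Y]

/-- Expansion of B(su - v, su - v) ≥ 0. Only semidefiniteness enters, as it must: the sheet form
vanishes on fields with no tangential trace on the sheet. -/
theorem young_bilin {B : LinearMap.BilinForm ℝ W} (hs : ∀ u v, B u v = B v u)
    (hp : ∀ u, 0 ≤ B u u) {s : ℝ} (hs0 : 0 < s) (u v : W) :
    2 * B u v ≤ s * B u u + s⁻¹ * B v v := by
  have h := hp (s • u - v)
  simp only [map_sub, map_smul, LinearMap.sub_apply, LinearMap.smul_apply, smul_eq_mul,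
    hs v u] at h
  have h2 : 0 ≤ s⁻¹ * (s * (s * B u u) - s * B u v - (s * B u v - B v v)) :=
    mul_nonneg (by positivity) (by linarith)
  have h3 : s⁻¹ * (s * (s * B u u) - s * B u v - (s * B u v - B v v))
      = s * B u u - 2 * B u v + s⁻¹ * B v v := by
    field_simp
    ring
  linarith

theorem neg_young_bilin {B : LinearMap.BilinForm ℝ W} (hs : ∀ u v, B u v = B v u)
    (hp : ∀ u, 0 ≤ B u u) {s : ℝ} (hs0 : 0 < s) (u v : W) :
    -(2 * B u v) ≤ s * B u u + s⁻¹ * B v v := by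
  have := young_bilin hs hp hs0 (-u) v
  simpa using this

theorem bilin_add_le {B : LinearMap.BilinForm ℝ W} (hs : ∀ u v, B u v = B v u)
    (hp : ∀ u, 0 ≤ B u u) (u v : W) : B (u + v) (u + v) ≤ 2 * B u u + 2 * B v v := by
  have h := hp (u - v)
  simp only [map_sub, map_add, LinearMap.sub_apply, LinearMap.add_apply, hs v u] at h ⊢
  linarith

theorem young_inner {s : ℝ} (hs0 : 0 < s) (u v : Y) :
    2 * inner ℝ u v ≤ s * ‖u‖ ^ 2 + s⁻¹ * ‖v‖ ^ 2 := by
  have h := young_bilin (B := innerₗ Y) (fun u v => real_inner_comm _ _)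
    (fun u => real_inner_self_nonneg) hs0 u v
  simpa [real_inner_self_eq_norm_sq] using h

theorem neg_young_inner {s : ℝ} (hs0 : 0 < s) (u v : Y) :
    -(2 * inner ℝ u v) ≤ s * ‖u‖ ^ 2 + s⁻¹ * ‖v‖ ^ 2 := by
  simpa using young_inner hs0 (-u) v

theorem norm_add_sq_le (u v : Y) : ‖u + v‖ ^ 2 ≤ 2 * ‖u‖ ^ 2 + 2 * ‖v‖ ^ 2 := by
  have := parallelogram_law_with_norm ℝ u v
  nlinarith [sq_nonneg ‖u - v‖]

end Forms

/-! ### The leapfrog scheme in abstract form -/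

/-- The leapfrog scheme on a real vector space `W` with positive semidefinite forms `A` (the `L²`
inner product) and `S` (the inner product of the tangential traces on the sheet), and a linear map
`L` (the curl) into an inner product space. Here `h n` stands for the value at `n + 1/2`. -/
structure LeapfrogSystem {W Y : Type*} [AddCommGroup W] [Module ℝ W] [NormedAddCommGroup Y]
    [InnerProductSpace ℝ Y] (p : Params) (τ : ℝ) (M : ℕ) (A S : LinearMap.BilinForm ℝ W)
    (L : W →ₗ[ℝ] Y) (V : Submodule ℝ W) (U : Submodule ℝ Y) (e : ℕ → W) (h k : ℕ → Y) : Prop where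
  A_symm : ∀ u v, A u v = A v u
  A_nonneg : ∀ u, 0 ≤ A u u
  S_symm : ∀ u v, S u v = S v u
  S_nonneg : ∀ u, 0 ≤ S u u
  map_mem : ∀ φ ∈ V, L φ ∈ U
  e_mem : ∀ n ≤ M + 1, e n ∈ V
  h_mem : ∀ n ≤ M, h n ∈ U
  e_step : ∀ n < M, ∀ φ ∈ V,
    p.ε₀ * ((τ ^ 2)⁻¹ * A (e (n + 2) - (2 : ℝ) • e (n + 1) + e n) φ)
      + p.ε₀ / p.τ₀ * ((2 * τ)⁻¹ * A (e (n + 2) - e n) φ)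
      + 1 / p.μ₀ * inner ℝ (L (e (n + 1))) (L φ)
    = 1 / p.τ₀ * (2⁻¹ * inner ℝ (h (n + 1) + h n) (L φ))
      - p.σ₀ / p.τ₀ * S (e (n + 1)) φ - 1 / p.μ₀ * inner ℝ (k (n + 1)) (L φ)
  h_step : ∀ n < M, ∀ ψ ∈ U,
    p.μ₀ * (τ⁻¹ * inner ℝ (h (n + 1) - h n) ψ)
      = - inner ℝ (L (e (n + 1))) ψ - inner ℝ (k (n + 1)) ψ

namespace LeapfrogSystem

variable {W Y : Type*} [AddCommGroup W] [Module ℝ W] [NormedAddCommGroup Y]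
    [InnerProductSpace ℝ Y]

/-- The discrete energy. -/
def eng (p : Params) (τ : ℝ) (A S : LinearMap.BilinForm ℝ W) (L : W →ₗ[ℝ] Y) (e : ℕ → W)
    (h : ℕ → Y) (n : ℕ) : ℝ :=
  p.ε₀ * ((τ ^ 2)⁻¹ * A (e (n + 1) - e n) (e (n + 1) - e n))
  + 1 / (2 * p.μ₀) * (‖L (e (n + 1))‖ ^ 2 + ‖L (e n)‖ ^ 2)
  + p.μ₀ * ‖h n‖ ^ 2
  + p.σ₀ / (2 * p.τ₀) * (S (e (n + 1)) (e (n + 1)) + S (e n) (e n))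
  + τ / (4 * p.μ₀ * p.τ₀) * (‖L (e (n + 1))‖ ^ 2 + ‖L (e n)‖ ^ 2)

/-- The initial energy and the contribution of the sources. -/
def data (p : Params) (τ : ℝ) (A S : LinearMap.BilinForm ℝ W) (L : W →ₗ[ℝ] Y) (e : ℕ → W)
    (h k : ℕ → Y) (M : ℕ) : ℝ :=
  eng p τ A S L e h 0 + ‖k 0‖ ^ 2 + ‖k 1‖ ^ 2 + τ * ∑ n ∈ Finset.range M,
    (‖k (n + 1)‖ ^ 2 + ‖(2 * τ)⁻¹ • (k (n + 2) - k n)‖ ^ 2)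

/-- The quantity whose increments are controlled explicitly: the staggered energy, corrected by the
boundary terms of the summations by parts. -/
def corrected (p : Params) (τ : ℝ) (A S : LinearMap.BilinForm ℝ W) (L : W →ₗ[ℝ] Y) (e : ℕ → W)
    (h k : ℕ → Y) (n : ℕ) : ℝ :=
  p.ε₀ * ((τ ^ 2)⁻¹ * A (e (n + 1) - e n) (e (n + 1) - e n))
  + 1 / p.μ₀ * inner ℝ (L (e (n + 1))) (L (e n))
  + p.σ₀ / p.τ₀ * S (e (n + 1)) (e n)
  - 1 / p.τ₀ * inner ℝ (h n + (τ / (2 * p.μ₀)) • (L (e n) + k n)) (L (e (n + 1)) + L (e n))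
  + 1 / p.μ₀ * (inner ℝ (k n) (L (e (n + 1))) + inner ℝ (k (n + 1)) (L (e n)))

variable {p : Params} {τ T : ℝ} {M : ℕ} {A S : LinearMap.BilinForm ℝ W} {L : W →ₗ[ℝ] Y}
    {V : Submodule ℝ W} {U : Submodule ℝ Y} {e : ℕ → W} {h k : ℕ → Y}

section
variable (hs : LeapfrogSystem p τ M A S L V U e h k) (hτ : 0 < τ)
include hs hτ

/-- Every summand of the energy is non-negative, so each is dominated by the total. -/
theorem eng_bounds (n : ℕ) :
    ‖L (e (n + 1))‖ ^ 2 + ‖L (e n)‖ ^ 2 ≤ 2 * p.μ₀ * eng p τ A S L e h n ∧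
    p.μ₀ * ‖h n‖ ^ 2 ≤ eng p τ A S L e h n ∧
    p.ε₀ * ((τ ^ 2)⁻¹ * A (e (n + 1) - e n) (e (n + 1) - e n)) ≤ eng p τ A S L e h n ∧
    p.σ₀ / (2 * p.τ₀) * (S (e (n + 1)) (e (n + 1)) + S (e n) (e n)) ≤ eng p τ A S L e h n ∧
    0 ≤ eng p τ A S L e h n := by
  have h1 := p.ε₀_pos
  have h2 := p.μ₀_pos
  have h3 := p.τ₀_pos
  have h4 := p.σ₀_pos
  have a1 : 0 ≤ p.ε₀ * ((τ ^ 2)⁻¹ * A (e (n + 1) - e n) (e (n + 1) - e n)) := by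
    have := hs.A_nonneg (e (n + 1) - e n)
    positivity
  have a2 : 0 ≤ 1 / (2 * p.μ₀) * (‖L (e (n + 1))‖ ^ 2 + ‖L (e n)‖ ^ 2) := by positivity
  have a3 : 0 ≤ p.μ₀ * ‖h n‖ ^ 2 := by positivity
  have a4 : 0 ≤ p.σ₀ / (2 * p.τ₀) * (S (e (n + 1)) (e (n + 1)) + S (e n) (e n)) := by
    have := hs.S_nonneg (e (n + 1))
    have := hs.S_nonneg (e n)
    positivity
  have a5 : 0 ≤ τ / (4 * p.μ₀ * p.τ₀) * (‖L (e (n + 1))‖ ^ 2 + ‖L (e n)‖ ^ 2) := by positivity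
  refine ⟨?_, ?_, ?_, ?_, ?_⟩
  · have : 1 / (2 * p.μ₀) * (‖L (e (n + 1))‖ ^ 2 + ‖L (e n)‖ ^ 2) ≤ eng p τ A S L e h n := by
      unfold eng; linarith
    rw [one_div, inv_mul_le_iff₀ (by positivity)] at this
    exact this
  all_goals unfold eng; linarith

/-- The field equation tested with e_{n+2} - e_n is combined with the magnetic equation tested with
the curls of e_{n+2} - e_n and of e_{n+1} + e_n. The last product in `corrected` turns the pairing
of k_{n+1} with a two-step difference of curls into one of a two-step difference of k with a single
curl. The bracket with h_n equals the mean of h_n and h_{n-1} by the magnetic equation; in this form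
it also makes sense at n = 0. -/
theorem corrected_step {n : ℕ} (hn : n < M) :
    corrected p τ A S L e h k (n + 1) ≤ corrected p τ A S L e h k n
      + τ / (2 * p.μ₀ * p.τ₀) * (‖L (e (n + 1)) + L (e n)‖ ^ 2
          + inner ℝ (k (n + 1) + k n) (L (e (n + 1)) + L (e n)))
      + 2 * τ / p.μ₀ * inner ℝ ((2 * τ)⁻¹ • (k (n + 2) - k n)) (L (e (n + 1))) := by
  have h1 := p.ε₀_pos
  have h2 := p.μ₀_pos
  have h3 := p.τ₀_pos
  have hV2 := hs.e_mem (n + 2) (by omega)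
  have hV1 := hs.e_mem (n + 1) (by omega)
  have hV0 := hs.e_mem n (by omega)
  have E := hs.e_step n hn (e (n + 2) - e n) (V.sub_mem hV2 hV0)
  have H1 := hs.h_step n hn (L (e (n + 2)) - L (e n))
    (U.sub_mem (hs.map_mem _ hV2) (hs.map_mem _ hV0))
  have H2 := hs.h_step n hn (L (e (n + 1)) + L (e n))
    (U.add_mem (hs.map_mem _ hV1) (hs.map_mem _ hV0))
  -- The damping term. It is the exact slack of the claim; everything else below is an identity.
  have P : 0 ≤ p.ε₀ / p.τ₀ * ((2 * τ)⁻¹ * A (e (n + 2) - e n) (e (n + 2) - e n)) := by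
    have := hs.A_nonneg (e (n + 2) - e n)
    positivity
  have EL : L (e (n + 2) - e n) = L (e (n + 2)) - L (e n) := map_sub _ _ _
  rw [EL] at E
  unfold corrected
  simp only [show n + 1 + 1 = n + 2 from rfl]
  set c0 := L (e n)
  set c1 := L (e (n + 1))
  set c2 := L (e (n + 2))
  have H1' : inner ℝ (h (n + 1) - h n) (c2 - c0) = -(τ / p.μ₀) * inner ℝ (c1 + k (n + 1)) (c2 - c0) := by
    rw [inner_add_left]
    field_simp at H1 ⊢
    linarith
  have H2' : inner ℝ (h (n + 1) - h n) (c1 + c0) = -(τ / p.μ₀) * inner ℝ (c1 + k (n + 1)) (c1 + c0) := by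
    rw [inner_add_left]
    field_simp at H2 ⊢
    linarith
  have EA : A (e (n + 2) - (2 : ℝ) • e (n + 1) + e n) (e (n + 2) - e n)
      = A (e (n + 2) - e (n + 1)) (e (n + 2) - e (n + 1))
        - A (e (n + 1) - e n) (e (n + 1) - e n) := by
    simp only [map_sub, map_add, map_smul, LinearMap.sub_apply, LinearMap.add_apply,
      LinearMap.smul_apply, smul_eq_mul, hs.A_symm (e n) (e (n + 1)), hs.A_symm (e n) (e (n + 2)),
      hs.A_symm (e (n + 1)) (e (n + 2))]
    ring
  have ES : S (e (n + 1)) (e (n + 2) - e n) = S (e (n + 2)) (e (n + 1)) - S (e (n + 1)) (e n) := by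
    rw [map_sub, hs.S_symm (e (n + 1)) (e (n + 2))]
  have R : 2 * τ / p.μ₀ * inner ℝ ((2 * τ)⁻¹ • (k (n + 2) - k n)) c1
      = 1 / p.μ₀ * inner ℝ (k (n + 2) - k n) c1 := by
    rw [real_inner_smul_left]
    field_simp
  rw [EA, ES] at E
  rw [R]
  have N : ‖c1 + c0‖ ^ 2 = inner ℝ (c1 + c0) (c1 + c0) := (real_inner_self_eq_norm_sq _).symm
  rw [N]
  have E' : inner ℝ (h (n + 1) + h n) (c2 - c0)
      = 2 * inner ℝ (h (n + 1)) (c2 - c0) - inner ℝ (h (n + 1) - h n) (c2 - c0) := by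
    simp only [inner_add_left, inner_sub_left]; ring
  rw [E', H1'] at E
  have key : 1 / p.τ₀ * inner ℝ (h (n + 1)) (c2 + c1) - 1 / p.τ₀ * inner ℝ (h n) (c1 + c0)
      = 1 / p.τ₀ * inner ℝ (h (n + 1)) (c2 - c0)
        - 1 / p.τ₀ * ((τ / p.μ₀) * inner ℝ (c1 + k (n + 1)) (c1 + c0)) := by
    rw [inner_sub_left] at H2'
    have : inner ℝ (h (n + 1)) (c2 + c1) = inner ℝ (h (n + 1)) (c2 - c0)
        + inner ℝ (h (n + 1)) (c1 + c0) := by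
      rw [← inner_add_right]; congr 1; abel
    rw [this]
    linear_combination (1 / p.τ₀) * H2'
  have q : p.τ₀ ≠ 0 := h3.ne'
  have q2 : p.μ₀ ≠ 0 := h2.ne'
  simp only [inner_add_left, inner_add_right, inner_sub_left, inner_sub_right,
    real_inner_smul_left, real_inner_comm c0 c1, real_inner_comm c1 c2] at E key ⊢
  have fin : ∀ a b : ℝ, 0 ≤ a → b = a → 0 ≤ b := fun a b h1 h2 => h2 ▸ h1
  rw [← sub_nonneg]
  refine fin _ _ P ?_
  linear_combination (-1) * E + key

end

end LeapfrogSystem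

/-! ### Bounds for the sources, the magnetic field and the corrected energy. -/

theorem sum_const_le {τ T c : ℝ} {M : ℕ} (hτ : 0 ≤ τ) (hT : M * τ ≤ T) {j : ℕ} (hj : j ≤ M)
    (hc : 0 ≤ c) : τ * ∑ _i ∈ Finset.range j, c ≤ T * c := by
  have : (j : ℝ) ≤ M := by exact_mod_cast hj
  calc τ * ∑ _i ∈ Finset.range j, c = j * τ * c := by simp; ring
    _ ≤ M * τ * c := by gcongr
    _ ≤ T * c := by gcongr

namespace LeapfrogSystem

variable {W Y : Type*} [AddCommGroup W] [Module ℝ W] [NormedAddCommGroup Y]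
    [InnerProductSpace ℝ Y]
variable {p : Params} {τ T : ℝ} {M : ℕ} {A S : LinearMap.BilinForm ℝ W} {L : W →ₗ[ℝ] Y}
    {V : Submodule ℝ W} {U : Submodule ℝ Y} {e : ℕ → W} {h k : ℕ → Y}

section
variable (hs : LeapfrogSystem p τ M A S L V U e h k) (hτ : 0 < τ)
include hs hτ

theorem data_bounds :
    eng p τ A S L e h 0 ≤ data p τ A S L e h k M ∧
    ‖k 0‖ ^ 2 + ‖k 1‖ ^ 2 + τ * ∑ n ∈ Finset.range M, ‖(2 * τ)⁻¹ • (k (n + 2) - k n)‖ ^ 2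
      ≤ data p τ A S L e h k M ∧
    0 ≤ data p τ A S L e h k M := by
  have h0 := (hs.eng_bounds hτ 0).2.2.2.2
  have h1 : 0 ≤ τ * ∑ n ∈ Finset.range M, ‖k (n + 1)‖ ^ 2 := by positivity
  have h2 : 0 ≤ τ * ∑ n ∈ Finset.range M, ‖(2 * τ)⁻¹ • (k (n + 2) - k n)‖ ^ 2 := by positivity
  have h3 : 0 ≤ ‖k 0‖ ^ 2 := by positivity
  have h4 : 0 ≤ ‖k 1‖ ^ 2 := by positivity
  unfold data
  rw [Finset.sum_add_distrib, mul_add]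
  refine ⟨by linarith, by linarith, by linarith⟩

/-- A discrete fundamental theorem of calculus. The centred differences link indices of equal
parity, so both k_0 and k_1 are needed as starting values; Cauchy–Schwarz in time turns the sum of
norms into the sum of squares at the price of a factor T. -/
theorem source_bound (hT : M * τ ≤ T) {n : ℕ} (hn : n ≤ M + 1) :
    ‖k n‖ ^ 2 ≤ (3 + 12 * T) * data p τ A S L e h k M := by
  obtain ⟨-, hd, hd0⟩ := hs.data_bounds hτ
  have hT0 : 0 ≤ T := le_trans (by positivity) hT
  set d : ℕ → Y := fun n => (2 * τ)⁻¹ • (k (n + 2) - k n)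
  set s := ∑ n ∈ Finset.range M, ‖d n‖ with hsdef
  have hs0 : 0 ≤ s := Finset.sum_nonneg fun _ _ => norm_nonneg _
  have step : ∀ n, ‖k (n + 2)‖ ≤ ‖k n‖ + 2 * τ * ‖d n‖ := by
    intro n
    have : k (n + 2) = k n + (2 * τ) • d n := by
      simp only [d]
      rw [smul_inv_smul₀ (by positivity)]
      abel
    rw [this]
    refine (norm_add_le _ _).trans_eq ?_
    rw [norm_smul, Real.norm_of_nonneg (by positivity)]
  -- Two consecutive bounds are carried because each step reaches back by two. The value k_n uses
  -- only differences with index at most n - 2; the truncated subtraction gives an empty sum for n =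
  -- 0, 1.
  have chain : ∀ n, ‖k n‖ ≤ ‖k 0‖ + ‖k 1‖ + 2 * τ * ∑ i ∈ Finset.range (n - 1), ‖d i‖ ∧
      ‖k (n + 1)‖ ≤ ‖k 0‖ + ‖k 1‖ + 2 * τ * ∑ i ∈ Finset.range n, ‖d i‖ := by
    intro n
    induction n with
    | zero => simp
    | succ n ih =>
      refine ⟨by simpa using ih.2, ?_⟩
      have h1 := step n
      have h2 : ∑ i ∈ Finset.range (n - 1), ‖d i‖ ≤ ∑ i ∈ Finset.range n, ‖d i‖ :=
        Finset.sum_le_sum_of_subset_of_nonneg (by simp) fun _ _ _ => norm_nonneg _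
      have h3 := mul_le_mul_of_nonneg_left h2 (by positivity : 0 ≤ 2 * τ)
      rw [Finset.sum_range_succ]
      linarith [ih.1]
  have hk : ‖k n‖ ≤ ‖k 0‖ + ‖k 1‖ + 2 * τ * s := by
    refine (chain n).1.trans ?_
    gcongr
    exact Finset.sum_le_sum_of_subset_of_nonneg (by simpa using hn) fun _ _ _ => norm_nonneg _
  have cs : s ^ 2 ≤ M * ∑ n ∈ Finset.range M, ‖d n‖ ^ 2 := by
    simpa using sq_sum_le_card_mul_sum_sq (s := Finset.range M) (f := fun n => ‖d n‖)
  set q := ∑ n ∈ Finset.range M, ‖d n‖ ^ 2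
  have hq : 0 ≤ q := Finset.sum_nonneg fun _ _ => sq_nonneg _
  have h5 : (τ * s) ^ 2 ≤ T * (τ * q) := by
    calc (τ * s) ^ 2 = τ ^ 2 * s ^ 2 := by ring
      _ ≤ τ ^ 2 * (M * q) := by gcongr
      _ = (M * τ) * (τ * q) := by ring
      _ ≤ _ := by gcongr
  have h6 : ‖k n‖ ^ 2 ≤ (‖k 0‖ + ‖k 1‖ + 2 * τ * s) ^ 2 := by gcongr
  have h7 : (‖k 0‖ + ‖k 1‖ + 2 * τ * s) ^ 2
      ≤ 3 * (‖k 0‖ ^ 2 + ‖k 1‖ ^ 2) + 12 * (τ * s) ^ 2 := by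
    nlinarith [sq_nonneg (‖k 0‖ - ‖k 1‖), sq_nonneg (‖k 0‖ - 2 * τ * s),
      sq_nonneg (‖k 1‖ - 2 * τ * s)]
  have h8 : T * (τ * q) ≤ T * data p τ A S L e h k M := by
    gcongr
    linarith [sq_nonneg ‖k 0‖, sq_nonneg ‖k 1‖]
  have h9 : 0 ≤ τ * q := by positivity
  linarith

/-- Testing with the increment of h and Cauchy–Schwarz show that this increment has norm at most
τ/μ₀ times that of curl plus source. After squaring, τ ≤ 1 reduces τ² to τ. -/
theorem magnetic_step (hτ1 : τ ≤ 1) {n : ℕ} (hn : n < M) :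
    ‖h (n + 1)‖ ^ 2 ≤ ‖h n‖ ^ 2
      + τ * (9 / p.μ₀ * eng p τ A S L e h n + 4 / p.μ₀ ^ 2 * ‖k (n + 1)‖ ^ 2) := by
  have h2 := p.μ₀_pos
  have hw := hs.h_step n hn (h (n + 1) - h n) (U.sub_mem (hs.h_mem _ (by omega)) (hs.h_mem _ (by omega)))
  set w := h (n + 1) - h n
  set g := L (e (n + 1)) + k (n + 1) with hg
  have hw1 : ‖w‖ ≤ τ / p.μ₀ * ‖g‖ := by
    have e1 : ‖w‖ * ‖w‖ = -(τ / p.μ₀) * inner ℝ g w := by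
      rw [hg, inner_add_left, ← real_inner_self_eq_norm_mul_norm]
      field_simp at hw ⊢
      linarith
    have e2 : -inner ℝ g w ≤ ‖g‖ * ‖w‖ := by
      have := abs_le.1 (abs_real_inner_le_norm g w)
      linarith
    have e3 : ‖w‖ * ‖w‖ ≤ τ / p.μ₀ * ‖g‖ * ‖w‖ := by
      have := mul_le_mul_of_nonneg_left e2 (by positivity : 0 ≤ τ / p.μ₀)
      linarith
    by_cases h0 : ‖w‖ = 0
    · rw [h0]; positivity
    · exact le_of_mul_le_mul_right e3 (lt_of_le_of_ne (norm_nonneg _) (Ne.symm h0))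
  have hh : ‖h (n + 1)‖ ≤ ‖h n‖ + τ / p.μ₀ * ‖g‖ := by
    have : h (n + 1) = h n + w := by simp [w]
    rw [this]
    exact (norm_add_le _ _).trans (by linarith)
  have hsq : ‖h (n + 1)‖ ^ 2 ≤ (‖h n‖ + τ / p.μ₀ * ‖g‖) ^ 2 := by gcongr
  have hG : ‖g‖ ^ 2 ≤ 2 * ‖L (e (n + 1))‖ ^ 2 + 2 * ‖k (n + 1)‖ ^ 2 := norm_add_sq_le _ _
  obtain ⟨b1, b2, -, -, b5⟩ := hs.eng_bounds hτ n
  set x := eng p τ A S L e h n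
  have e1 : (‖h n‖ + τ / p.μ₀ * ‖g‖) ^ 2
      ≤ ‖h n‖ ^ 2 + τ * (‖h n‖ ^ 2 + 2 / p.μ₀ ^ 2 * ‖g‖ ^ 2) := by
    have t1 : τ ^ 2 * (‖g‖ / p.μ₀) ^ 2 ≤ τ * (‖g‖ / p.μ₀) ^ 2 := by
      have : τ ^ 2 ≤ τ := by nlinarith
      gcongr
    have t2 : 0 ≤ τ * (‖h n‖ - ‖g‖ / p.μ₀) ^ 2 := by positivity
    have t3 : τ / p.μ₀ * ‖g‖ = τ * (‖g‖ / p.μ₀) := by ring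
    have t4 : 2 / p.μ₀ ^ 2 * ‖g‖ ^ 2 = 2 * (‖g‖ / p.μ₀) ^ 2 := by field_simp
    rw [t3, t4]
    nlinarith
  have e2 : ‖h n‖ ^ 2 + 2 / p.μ₀ ^ 2 * ‖g‖ ^ 2 ≤ 9 / p.μ₀ * x + 4 / p.μ₀ ^ 2 * ‖k (n + 1)‖ ^ 2 := by
    have t1 : ‖h n‖ ^ 2 ≤ x / p.μ₀ := by rw [le_div_iff₀ h2]; linarith
    have t2 : ‖g‖ ^ 2 ≤ 4 * p.μ₀ * x + 2 * ‖k (n + 1)‖ ^ 2 := by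
      linarith [sq_nonneg ‖L (e n)‖]
    have t3 := mul_le_mul_of_nonneg_left t2 (by positivity : 0 ≤ 2 / p.μ₀ ^ 2)
    have t4 : 2 / p.μ₀ ^ 2 * (4 * p.μ₀ * x + 2 * ‖k (n + 1)‖ ^ 2)
        = 8 / p.μ₀ * x + 4 / p.μ₀ ^ 2 * ‖k (n + 1)‖ ^ 2 := by field_simp; ring
    have t5 : x / p.μ₀ + 8 / p.μ₀ * x = 9 / p.μ₀ * x := by ring
    linarith
  have := mul_le_mul_of_nonneg_left e2 hτ.le
  linarith

/-- The corrected energy has no term ‖h‖², so the magnetic part is recovered here from the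
accumulated energy. -/
theorem magnetic_bound (hτ1 : τ ≤ 1) (hT : M * τ ≤ T) {j : ℕ} (hj : j ≤ M) :
    ‖h j‖ ^ 2 ≤ (10 / p.μ₀ + 4 / p.μ₀ ^ 2 * (T * (3 + 12 * T))) *
      (data p τ A S L e h k M + τ * ∑ i ∈ Finset.range j, eng p τ A S L e h i) := by
  have h2 := p.μ₀_pos
  have hT0 : 0 ≤ T := le_trans (by positivity) hT
  obtain ⟨d1, -, d0⟩ := hs.data_bounds hτ
  set F := data p τ A S L e h k M
  have hstep : ∀ n < M, ‖h (n + 1)‖ ^ 2 ≤ ‖h n‖ ^ 2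
      + τ * (9 / p.μ₀ * eng p τ A S L e h n + 4 / p.μ₀ ^ 2 * ((3 + 12 * T) * F)) := by
    intro n hn
    refine (hs.magnetic_step hτ hτ1 hn).trans ?_
    gcongr
    exact hs.source_bound hτ hT (by omega)
  have h3 := le_add_sum_of_step (y := fun n => ‖h n‖ ^ 2) hstep j hj
  rw [Finset.sum_add_distrib, mul_add, ← Finset.mul_sum] at h3
  have h4 := sum_const_le hτ.le hT hj (c := 4 / p.μ₀ ^ 2 * ((3 + 12 * T) * F)) (by positivity)
  set X := ∑ i ∈ Finset.range j, eng p τ A S L e h i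
  have hX : 0 ≤ τ * X := mul_nonneg hτ.le (Finset.sum_nonneg fun i _ => (hs.eng_bounds hτ i).2.2.2.2)
  have h5 : ‖h 0‖ ^ 2 ≤ F / p.μ₀ := by
    rw [le_div_iff₀ h2]; linarith [(hs.eng_bounds hτ 0).2.1]
  have h6 : 0 ≤ (1 / p.μ₀ + 4 / p.μ₀ ^ 2 * (T * (3 + 12 * T))) * (τ * X) := by positivity
  have h7 : 0 ≤ 9 / p.μ₀ * F := by positivity
  have : (10 / p.μ₀ + 4 / p.μ₀ ^ 2 * (T * (3 + 12 * T))) * (F + τ * X)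
    = F / p.μ₀ + 9 / p.μ₀ * F + 9 / p.μ₀ * (τ * X) + T * (4 / p.μ₀ ^ 2 * ((3 + 12 * T) * F))
      + (1 / p.μ₀ + 4 / p.μ₀ ^ 2 * (T * (3 + 12 * T))) * (τ * X) := by ring
  linarith

/-- Young's inequality termwise. The mixed curl and sheet products are bounded by the corresponding
squares in the initial energy, and the rest by multiples of the data. -/
theorem corrected_zero_le (hτ1 : τ ≤ 1) :
    corrected p τ A S L e h k 0 ≤
      (2 + 9 / (2 * p.τ₀) + 1 / (2 * p.μ₀ * p.τ₀) + 1 / (2 * p.μ₀)) *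
        data p τ A S L e h k M := by
  have h1 := p.ε₀_pos
  have h2 := p.μ₀_pos
  have h3 := p.τ₀_pos
  have h4 := p.σ₀_pos
  obtain ⟨d1, d2, d0⟩ := hs.data_bounds hτ
  obtain ⟨b1, b2, b3, b4, b5⟩ := hs.eng_bounds hτ 0
  have dsum : 0 ≤ τ * ∑ n ∈ Finset.range M, ‖(2 * τ)⁻¹ • (k (n + 2) - k n)‖ ^ 2 := by positivity
  set F := data p τ A S L e h k M
  have hx : eng p τ A S L e h 0 = p.ε₀ * ((τ ^ 2)⁻¹ * A (e (0 + 1) - e 0) (e (0 + 1) - e 0))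
    + 1 / (2 * p.μ₀) * (‖L (e (0 + 1))‖ ^ 2 + ‖L (e 0)‖ ^ 2)
    + p.μ₀ * ‖h 0‖ ^ 2
    + p.σ₀ / (2 * p.τ₀) * (S (e (0 + 1)) (e (0 + 1)) + S (e 0) (e 0))
    + τ / (4 * p.μ₀ * p.τ₀) * (‖L (e (0 + 1))‖ ^ 2 + ‖L (e 0)‖ ^ 2) := rfl
  set x := eng p τ A S L e h 0
  unfold corrected
  set c1 := L (e (0 + 1))
  set c0 := L (e 0)
  have P : 0 ≤ τ / (4 * p.μ₀ * p.τ₀) * (‖c1‖ ^ 2 + ‖c0‖ ^ 2) := by positivity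
  have P2 : 0 ≤ p.μ₀ * ‖h 0‖ ^ 2 := by positivity
  have i1 : 1 / p.μ₀ * inner ℝ c1 c0 ≤ 1 / (2 * p.μ₀) * (‖c1‖ ^ 2 + ‖c0‖ ^ 2) := by
    have := young_inner (one_pos) c1 c0
    have := mul_le_mul_of_nonneg_left this (by positivity : 0 ≤ 1 / (2 * p.μ₀))
    calc _ = 1 / (2 * p.μ₀) * (2 * inner ℝ c1 c0) := by ring
      _ ≤ _ := this
      _ = _ := by simp
  have i2 : p.σ₀ / p.τ₀ * S (e (0 + 1)) (e 0)
      ≤ p.σ₀ / (2 * p.τ₀) * (S (e (0 + 1)) (e (0 + 1)) + S (e 0) (e 0)) := by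
    have := young_bilin hs.S_symm hs.S_nonneg (one_pos) (e (0 + 1)) (e 0)
    have := mul_le_mul_of_nonneg_left this (by positivity : 0 ≤ p.σ₀ / (2 * p.τ₀))
    calc _ = p.σ₀ / (2 * p.τ₀) * (2 * S (e (0 + 1)) (e 0)) := by ring
      _ ≤ _ := this
      _ = _ := by simp
  have hD : ‖c1 + c0‖ ^ 2 ≤ 4 * p.μ₀ * F := by
    have := norm_add_sq_le c1 c0
    have := mul_le_mul_of_nonneg_left d1 (by positivity : 0 ≤ 4 * p.μ₀)
    linarith
  have hF1 : ‖k 0‖ ^ 2 ≤ F := by linarith [sq_nonneg ‖k 1‖]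
  have i3 : -(1 / p.τ₀ * inner ℝ (h 0) (c1 + c0)) ≤ 5 / (2 * p.τ₀) * F := by
    have t := neg_young_inner h2 (h 0) (c1 + c0)
    have t2 : p.μ₀⁻¹ * ‖c1 + c0‖ ^ 2 ≤ 4 * F := by
      rw [inv_mul_le_iff₀ h2]; linarith
    have t3 : p.μ₀ * ‖h 0‖ ^ 2 ≤ F := by linarith
    have t4 := mul_le_mul_of_nonneg_left (t.trans (add_le_add t3 t2))
      (by positivity : 0 ≤ 1 / (2 * p.τ₀))
    calc _ = 1 / (2 * p.τ₀) * -(2 * inner ℝ (h 0) (c1 + c0)) := by ring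
      _ ≤ _ := t4
      _ = _ := by ring
  have i4 : -(1 / p.τ₀ * (τ / (2 * p.μ₀) * inner ℝ (c0 + k 0) (c1 + c0)))
      ≤ (2 / p.τ₀ + 1 / (2 * p.μ₀ * p.τ₀)) * F := by
    have t := neg_young_inner one_pos (c0 + k 0) (c1 + c0)
    have t1 : ‖c0 + k 0‖ ^ 2 ≤ 4 * p.μ₀ * F + 2 * F := by
      have := norm_add_sq_le c0 (k 0)
      have := mul_le_mul_of_nonneg_left d1 (by positivity : 0 ≤ 2 * p.μ₀)
      linarith [sq_nonneg ‖c1‖]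
    have t2 : τ * -(2 * inner ℝ (c0 + k 0) (c1 + c0)) ≤ 1 * (8 * p.μ₀ * F + 2 * F) := by
      refine (mul_le_mul_of_nonneg_left (b := -(2 * inner ℝ (c0 + k 0) (c1 + c0)))
        (c := 8 * p.μ₀ * F + 2 * F) ?_ hτ.le).trans ?_
      · simp only [one_mul, inv_one] at t
        linarith
      · gcongr
    have t4 := mul_le_mul_of_nonneg_left t2 (by positivity : 0 ≤ 1 / (4 * p.μ₀ * p.τ₀))
    calc _ = 1 / (4 * p.μ₀ * p.τ₀) * (τ * -(2 * inner ℝ (c0 + k 0) (c1 + c0))) := by ring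
      _ ≤ _ := t4
      _ = _ := by field_simp; ring
  have i5 : 1 / p.μ₀ * (inner ℝ (k 0) c1 + inner ℝ (k (0 + 1)) c0) ≤ (1 / (2 * p.μ₀) + 1) * F := by
    have t := young_inner one_pos (k 0) c1
    have t' := young_inner one_pos (k (0 + 1)) c0
    have t1 : 2 * (inner ℝ (k 0) c1 + inner ℝ (k (0 + 1)) c0) ≤ F + 2 * p.μ₀ * F := by
      have := mul_le_mul_of_nonneg_left d1 (by positivity : 0 ≤ 2 * p.μ₀)
      simp only [one_mul, inv_one, zero_add] at t t' ⊢
      linarith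
    have t4 := mul_le_mul_of_nonneg_left t1 (by positivity : 0 ≤ 1 / (2 * p.μ₀))
    calc _ = 1 / (2 * p.μ₀) * (2 * (inner ℝ (k 0) c1 + inner ℝ (k (0 + 1)) c0)) := by ring
      _ ≤ _ := t4
      _ = _ := by field_simp
  rw [inner_add_left, real_inner_smul_left, mul_add]
  calc _ ≤ F + 5 / (2 * p.τ₀) * F + (2 / p.τ₀ + 1 / (2 * p.μ₀ * p.τ₀)) * F
        + (1 / (2 * p.μ₀) + 1) * F := by linarith
    _ = _ := by ring

/-- Summation of `corrected_step`. The energy of each step enters with weight τ, the uniform bound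
of the sources contributes a factor T, and the squared differences of k are already part of the
data. -/
theorem corrected_bound (hτ1 : τ ≤ 1) (hT : M * τ ≤ T) {j : ℕ} (hj : j ≤ M) :
    corrected p τ A S L e h k j ≤
      ((2 + 9 / (2 * p.τ₀) + 1 / (2 * p.μ₀ * p.τ₀) + 1 / (2 * p.μ₀)) + (3 / p.τ₀ + 2)
        + T * ((3 + 12 * T) / (p.μ₀ * p.τ₀)) + 1 / p.μ₀) *
      (data p τ A S L e h k M + τ * ∑ i ∈ Finset.range j, eng p τ A S L e h i) := by
  have h2 := p.μ₀_pos
  have h3 := p.τ₀_pos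
  have hT0 : 0 ≤ T := le_trans (by positivity) hT
  obtain ⟨d1, d2, d0⟩ := hs.data_bounds hτ
  have hG0 := hs.corrected_zero_le hτ hτ1
  have hsrc : ∀ n ≤ M + 1, ‖k n‖ ^ 2 ≤ (3 + 12 * T) * data p τ A S L e h k M :=
    fun n hn => hs.source_bound hτ hT hn
  set F := data p τ A S L e h k M
  have hstep : ∀ n < M, corrected p τ A S L e h k (n + 1) ≤ corrected p τ A S L e h k n
      + τ * ((3 / p.τ₀ + 2) * eng p τ A S L e h n + (3 + 12 * T) / (p.μ₀ * p.τ₀) * F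
        + 1 / p.μ₀ * ‖(2 * τ)⁻¹ • (k (n + 2) - k n)‖ ^ 2) := by
    intro n hn
    refine (hs.corrected_step hτ hn).trans ?_
    obtain ⟨b1, -, -, -, -⟩ := hs.eng_bounds hτ n
    set x := eng p τ A S L e h n
    set D := L (e (n + 1)) + L (e n) with hD
    set d := (2 * τ)⁻¹ • (k (n + 2) - k n)
    have t1 : ‖D‖ ^ 2 ≤ 4 * p.μ₀ * x := by
      have := norm_add_sq_le (L (e (n + 1))) (L (e n))
      linarith
    have t2 : inner ℝ (k (n + 1) + k n) D ≤ 2 * ((3 + 12 * T) * F) + 2 * p.μ₀ * x := by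
      have a1 := young_inner one_pos (k (n + 1) + k n) D
      have a2 := norm_add_sq_le (k (n + 1)) (k n)
      have a3 := hsrc n (by omega)
      have a4 := hsrc (n + 1) (by omega)
      simp only [one_mul, inv_one] at a1
      linarith
    have t3 : 2 * inner ℝ d (L (e (n + 1))) ≤ ‖d‖ ^ 2 + 2 * p.μ₀ * x := by
      have a1 := young_inner one_pos d (L (e (n + 1)))
      simp only [one_mul, inv_one] at a1
      linarith [sq_nonneg ‖L (e n)‖]
    have t4 := mul_le_mul_of_nonneg_left (add_le_add t1 t2)
      (by positivity : 0 ≤ τ / (2 * p.μ₀ * p.τ₀))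
    have t5 := mul_le_mul_of_nonneg_left t3 (by positivity : 0 ≤ τ / p.μ₀)
    calc _ = corrected p τ A S L e h k n
          + τ / (2 * p.μ₀ * p.τ₀) * (‖D‖ ^ 2 + inner ℝ (k (n + 1) + k n) D)
          + τ / p.μ₀ * (2 * inner ℝ d (L (e (n + 1)))) := by ring
      _ ≤ corrected p τ A S L e h k n
          + τ / (2 * p.μ₀ * p.τ₀) * (4 * p.μ₀ * x + (2 * ((3 + 12 * T) * F) + 2 * p.μ₀ * x))
          + τ / p.μ₀ * (‖d‖ ^ 2 + 2 * p.μ₀ * x) := by linarith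
      _ = _ := by field_simp; ring
  have h4 := le_add_sum_of_step (y := corrected p τ A S L e h k) hstep j hj
  rw [Finset.sum_add_distrib, Finset.sum_add_distrib, mul_add, mul_add] at h4
  have h5 := sum_const_le hτ.le hT hj (c := (3 + 12 * T) / (p.μ₀ * p.τ₀) * F) (by positivity)
  simp only [← Finset.mul_sum] at h4 h5
  have h6 : τ * ∑ n ∈ Finset.range j, ‖(2 * τ)⁻¹ • (k (n + 2) - k n)‖ ^ 2 ≤ F := by
    refine le_trans ?_ ((le_add_of_nonneg_left (by positivity)).trans d2)
    gcongr
  have h7 := mul_le_mul_of_nonneg_left h6 (by positivity : 0 ≤ 1 / p.μ₀)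
  set X := ∑ i ∈ Finset.range j, eng p τ A S L e h i
  have hX : 0 ≤ τ * X :=
    mul_nonneg hτ.le (Finset.sum_nonneg fun i _ => (hs.eng_bounds hτ i).2.2.2.2)
  have h8 : 0 ≤ ((2 + 9 / (2 * p.τ₀) + 1 / (2 * p.μ₀ * p.τ₀) + 1 / (2 * p.μ₀))
        + T * ((3 + 12 * T) / (p.μ₀ * p.τ₀)) + 1 / p.μ₀) * (τ * X) := by positivity
  have h9 : 0 ≤ (3 / p.τ₀ + 2) * F := by positivity
  linarith

end
end LeapfrogSystem
-- From the corrected energy back to the energy, and the crude one-step bound.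
namespace LeapfrogSystem

variable {W Y : Type*} [AddCommGroup W] [Module ℝ W] [NormedAddCommGroup Y]
    [InnerProductSpace ℝ Y]
variable {p : Params} {τ T : ℝ} {M : ℕ} {A S : LinearMap.BilinForm ℝ W} {L : W →ₗ[ℝ] Y}
    {V : Submodule ℝ W} {U : Submodule ℝ Y} {e : ℕ → W} {h k : ℕ → Y}

section
variable (hs : LeapfrogSystem p τ M A S L V U e h k) (hτ : 0 < τ)
include hs hτ

/-- The energy is controlled by the corrected energy if the time step is small compared with the
norms of the curl and of the trace. -/
theorem eng_le_corrected (hτ1 : τ ≤ 1)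
    (hL : ∀ φ ∈ V, 1 / (2 * p.μ₀) * ‖L φ‖ ^ 2 ≤ p.ε₀ / 8 * ((τ ^ 2)⁻¹ * A φ φ))
    (hS : ∀ φ ∈ V, p.σ₀ / (2 * p.τ₀) * S φ φ ≤ p.ε₀ / 8 * ((τ ^ 2)⁻¹ * A φ φ))
    {n : ℕ} (hn : n < M) :
    eng p τ A S L e h (n + 1) ≤ (2 + 1 / p.τ₀) * (corrected p τ A S L e h k (n + 1)
        + 2 * p.μ₀ / p.τ₀ ^ 2 * (‖h (n + 1)‖ ^ 2 + ‖h n‖ ^ 2)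
        + 2 / p.μ₀ * (‖k (n + 1)‖ ^ 2 + ‖k (n + 2)‖ ^ 2))
      + p.μ₀ * ‖h (n + 1)‖ ^ 2 := by
  have h1 := p.ε₀_pos
  have h2 := p.μ₀_pos
  have h3 := p.τ₀_pos
  have h4 := p.σ₀_pos
  have hV2 := hs.e_mem (n + 2) (by omega)
  have hV1 := hs.e_mem (n + 1) (by omega)
  have hL1 := hL _ (V.sub_mem hV2 hV1)
  have hS1 := hS _ (V.sub_mem hV2 hV1)
  have H2 := hs.h_step n hn (L (e (n + 2)) + L (e (n + 1)))
    (U.add_mem (hs.map_mem _ hV2) (hs.map_mem _ hV1))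
  have hA : 0 ≤ p.ε₀ * ((τ ^ 2)⁻¹ * A (e (n + 2) - e (n + 1)) (e (n + 2) - e (n + 1))) := by
    have := hs.A_nonneg (e (n + 2) - e (n + 1))
    positivity
  have hS2 := hs.S_nonneg (e (n + 2))
  have hS3 := hs.S_nonneg (e (n + 1))
  unfold eng corrected
  simp only [show n + 1 + 1 = n + 2 from rfl]
  set a := p.ε₀ * ((τ ^ 2)⁻¹ * A (e (n + 2) - e (n + 1)) (e (n + 2) - e (n + 1)))
  -- Polarisation: the defect between the mixed product and the squares is the square of L, or of
  -- the trace, on e_{n+2} - e_{n+1}. Each of the two defects costs an eighth of the kinetic term a.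
  have hLs : L (e (n + 2) - e (n + 1)) = L (e (n + 2)) - L (e (n + 1)) := map_sub _ _ _
  rw [hLs, norm_sub_sq_real] at hL1
  have hSs : S (e (n + 2) - e (n + 1)) (e (n + 2) - e (n + 1))
      = S (e (n + 2)) (e (n + 2)) + S (e (n + 1)) (e (n + 1)) - 2 * S (e (n + 2)) (e (n + 1)) := by
    simp only [map_sub, LinearMap.sub_apply, hs.S_symm (e (n + 1)) (e (n + 2))]
    ring
  rw [hSs] at hS1
  set c' := L (e (n + 2))
  set c := L (e (n + 1))
  set Q := S (e (n + 2)) (e (n + 2)) + S (e (n + 1)) (e (n + 1)) with hQ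
  have hQ0 : 0 ≤ p.σ₀ / (2 * p.τ₀) * Q := by positivity
  set P := ‖c'‖ ^ 2 + ‖c‖ ^ 2 with hP
  have hP0 : 0 ≤ P := by positivity
  have i1 : 1 / (2 * p.μ₀) * P - a / 8 ≤ 1 / p.μ₀ * inner ℝ c' c := by
    have : 1 / (2 * p.μ₀) * (‖c'‖ ^ 2 - 2 * inner ℝ c' c + ‖c‖ ^ 2)
        = 1 / (2 * p.μ₀) * P - 1 / p.μ₀ * inner ℝ c' c := by ring
    linarith
  have i2 : p.σ₀ / (2 * p.τ₀) * Q - a / 8 ≤ p.σ₀ / p.τ₀ * S (e (n + 2)) (e (n + 1)) := by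
    have : p.σ₀ / (2 * p.τ₀) * (Q - 2 * S (e (n + 2)) (e (n + 1)))
        = p.σ₀ / (2 * p.τ₀) * Q - p.σ₀ / p.τ₀ * S (e (n + 2)) (e (n + 1)) := by ring
    linarith
  have hD : ‖c' + c‖ ^ 2 ≤ 2 * P := by
    have := norm_add_sq_le c' c
    linarith
  -- By the magnetic equation the bracket is half of h_{n+1} + h_n. The Young weight 4μ₀/τ₀ makes
  -- the curl share exactly P/(8μ₀); the source terms in `i4` take the same share, which leaves
  -- P/(4μ₀).
  have i3 : 1 / p.τ₀ * inner ℝ (h (n + 1) + (τ / (2 * p.μ₀)) • (c + k (n + 1))) (c' + c)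
      ≤ 2 * p.μ₀ / p.τ₀ ^ 2 * (‖h (n + 1)‖ ^ 2 + ‖h n‖ ^ 2) + 1 / (8 * p.μ₀) * P := by
    have e1 : inner ℝ (h (n + 1) + (τ / (2 * p.μ₀)) • (c + k (n + 1))) (c' + c)
        = 2⁻¹ * inner ℝ (h (n + 1) + h n) (c' + c) := by
      rw [inner_sub_left] at H2
      rw [inner_add_left, real_inner_smul_left, inner_add_left, inner_add_left]
      field_simp at H2 ⊢
      linarith
    have e2 := young_inner (s := 4 * p.μ₀ / p.τ₀) (by positivity) (h (n + 1) + h n) (c' + c)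
    have e3 := norm_add_sq_le (h (n + 1)) (h n)
    have e4 := mul_le_mul_of_nonneg_left e3 (by positivity : 0 ≤ 4 * p.μ₀ / p.τ₀)
    have e5 := mul_le_mul_of_nonneg_left hD (by positivity : 0 ≤ (4 * p.μ₀ / p.τ₀)⁻¹)
    have e6 := mul_le_mul_of_nonneg_left (e2.trans (add_le_add e4 e5))
      (by positivity : 0 ≤ 1 / (4 * p.τ₀))
    rw [e1]
    calc _ = 1 / (4 * p.τ₀) * (2 * inner ℝ (h (n + 1) + h n) (c' + c)) := by ring
      _ ≤ _ := e6
      _ = _ := by field_simp; ring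
  have i4 : -(1 / p.μ₀ * (inner ℝ (k (n + 1)) c' + inner ℝ (k (n + 2)) c))
      ≤ 2 / p.μ₀ * (‖k (n + 1)‖ ^ 2 + ‖k (n + 2)‖ ^ 2) + 1 / (8 * p.μ₀) * P := by
    have e1 := neg_young_inner (s := 4) (by norm_num) (k (n + 1)) c'
    have e2 := neg_young_inner (s := 4) (by norm_num) (k (n + 2)) c
    have e6 := mul_le_mul_of_nonneg_left (add_le_add e1 e2) (by positivity : 0 ≤ 1 / (2 * p.μ₀))
    calc _ = 1 / (2 * p.μ₀) * (-(2 * inner ℝ (k (n + 1)) c') + -(2 * inner ℝ (k (n + 2)) c)) := by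
          ring
      _ ≤ _ := e6
      _ = _ := by rw [hP]; ring
  have i5 : 3 / 4 * a + 1 / (4 * p.μ₀) * P + p.σ₀ / (2 * p.τ₀) * Q ≤
      a + 1 / p.μ₀ * inner ℝ c' c + p.σ₀ / p.τ₀ * S (e (n + 2)) (e (n + 1))
      - 1 / p.τ₀ * inner ℝ (h (n + 1) + (τ / (2 * p.μ₀)) • (c + k (n + 1))) (c' + c)
      + 1 / p.μ₀ * (inner ℝ (k (n + 1)) c' + inner ℝ (k (n + 2)) c)
      + 2 * p.μ₀ / p.τ₀ ^ 2 * (‖h (n + 1)‖ ^ 2 + ‖h n‖ ^ 2)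
      + 2 / p.μ₀ * (‖k (n + 1)‖ ^ 2 + ‖k (n + 2)‖ ^ 2) := by
    have : 1 / (2 * p.μ₀) * P = 1 / (4 * p.μ₀) * P + 1 / (8 * p.μ₀) * P + 1 / (8 * p.μ₀) * P := by
      field_simp; ring
    linarith
  -- The factor 2 restores P/(2μ₀) from P/(4μ₀), and 1/τ₀ pays for the last term of the energy,
  -- where τ ≤ 1 is used.
  have i6 := mul_le_mul_of_nonneg_left i5 (by positivity : 0 ≤ 2 + 1 / p.τ₀)
  have i7 : τ / (4 * p.μ₀ * p.τ₀) * P ≤ 1 / (4 * p.μ₀ * p.τ₀) * P := by gcongr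
  have i8 : (2 + 1 / p.τ₀) * (3 / 4 * a + 1 / (4 * p.μ₀) * P + p.σ₀ / (2 * p.τ₀) * Q)
      = 3 / 2 * a + 2 * (p.σ₀ / (2 * p.τ₀) * Q) + 1 / (2 * p.μ₀) * P + 1 / (4 * p.μ₀ * p.τ₀) * P
        + 1 / p.τ₀ * (3 / 4 * a + p.σ₀ / (2 * p.τ₀) * Q) := by
    field_simp; ring
  have i9 : 0 ≤ 1 / p.τ₀ * (3 / 4 * a + p.σ₀ / (2 * p.τ₀) * Q) := by positivity
  linarith

/-- A bound for one step of the scheme, with constants that depend on bounds of the curl and of the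
trace and on a lower bound for the time step. -/
theorem eng_succ_le (hτ1 : τ ≤ 1) {t CL CS : ℝ} (ht : 0 < t) (htτ : t ≤ τ) (hCL : 0 < CL)
    (hCS : 0 < CS) (hL : ∀ φ ∈ V, ‖L φ‖ ^ 2 ≤ CL * A φ φ) (hS : ∀ φ ∈ V, S φ φ ≤ CS * A φ φ)
    {n : ℕ} (hn : n < M) {R : ℝ} (hx : eng p τ A S L e h n ≤ R) (hh0 : ‖h n‖ ^ 2 ≤ R)
    (hh1 : ‖h (n + 1)‖ ^ 2 ≤ R) (hk : ‖k (n + 1)‖ ^ 2 ≤ R) :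
    ∀ KA, KA = 2 * ((8 / (5 * p.ε₀)) * ((2 / p.τ₀ ^ 2) +
        (2 * CL / p.ε₀) * (2 / p.τ₀ ^ 2 + 2 * (4 * p.μ₀ + 2) / p.μ₀ ^ 2)
        + 4 * CS * p.σ₀ / (p.ε₀ * p.τ₀))) + 2 / p.ε₀ →
    eng p τ A S L e h (n + 1) ≤ (p.ε₀ * (t ^ 2)⁻¹ * KA
      + (1 / (2 * p.μ₀) + 1 / (4 * p.μ₀ * p.τ₀)) * (6 * p.μ₀ + 2 * CL * KA)
      + p.μ₀ + p.σ₀ / (2 * p.τ₀) * (6 * p.τ₀ / p.σ₀ + 2 * CS * KA)) * R := by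
  intro KA hKA
  have h1 := p.ε₀_pos
  have h2 := p.μ₀_pos
  have h3 := p.τ₀_pos
  have h4 := p.σ₀_pos
  have hV2 := hs.e_mem (n + 2) (by omega)
  have hV1 := hs.e_mem (n + 1) (by omega)
  have hV0 := hs.e_mem n (by omega)
  obtain ⟨b1, b2, b3, b4, b5⟩ := hs.eng_bounds hτ n
  set d := e (n + 2) - (2 : ℝ) • e (n + 1) + e n with hd
  set b := e (n + 1) - e n with hb
  have hdV : d ∈ V := V.add_mem (V.sub_mem hV2 (V.smul_mem _ hV1)) hV0
  have hbV : b ∈ V := V.sub_mem hV1 hV0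
  -- The test function is the second difference d, so the leading term is ε₀ τ⁻² A(d, d). Since
  -- e_{n+2} - e_n = d + 2b, the damping term is a non-negative part plus a product with the known
  -- increment b.
  have E := hs.e_step n hn d hdV
  have e2 : e (n + 2) - e n = d + (2 : ℝ) • b := by rw [hd, hb]; module
  have e1 : e (n + 2) - e (n + 1) = d + b := by rw [hd, hb]; module
  have hR0 : 0 ≤ R := b5.trans hx
  have hτ2 : 1 ≤ (τ ^ 2)⁻¹ := (one_le_inv₀ (by positivity)).2 (by nlinarith)
  have hAd := hs.A_nonneg d
  have hAb := hs.A_nonneg b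
  have hAbt : (τ ^ 2)⁻¹ * A b b ≤ R / p.ε₀ := by
    rw [le_div_iff₀ h1]; linarith
  have hSe : S (e (n + 1)) (e (n + 1)) ≤ 2 * p.τ₀ / p.σ₀ * R := by
    have := hs.S_nonneg (e n)
    have q : S (e (n + 1)) (e (n + 1)) + S (e n) (e n) ≤ 2 * p.τ₀ / p.σ₀ * R := by
      have := mul_le_mul_of_nonneg_left (b4.trans hx) (by positivity : 0 ≤ 2 * p.τ₀ / p.σ₀)
      refine le_trans (le_of_eq ?_) this
      field_simp
    linarith
  have hc : ‖L (e (n + 1))‖ ^ 2 ≤ 2 * p.μ₀ * R := by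
    have := mul_le_mul_of_nonneg_left hx (by positivity : 0 ≤ 2 * p.μ₀)
    linarith [sq_nonneg ‖L (e n)‖]
  -- the terms on the right-hand side of the equation tested with `d`
  have T1 : -(p.ε₀ / p.τ₀ * ((2 * τ)⁻¹ * (2 * A b d)))
      ≤ p.ε₀ / 8 * A d d + 2 / p.τ₀ ^ 2 * R := by
    have y := neg_young_bilin hs.A_symm hs.A_nonneg (s := 4 / (p.τ₀ * τ)) (by positivity) b d
    have := mul_le_mul_of_nonneg_left y (by positivity : 0 ≤ p.ε₀ / p.τ₀ * (2 * τ)⁻¹)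
    have z := mul_le_mul_of_nonneg_left hAbt (by positivity : 0 ≤ 2 * p.ε₀ / p.τ₀ ^ 2)
    calc _ = p.ε₀ / p.τ₀ * (2 * τ)⁻¹ * -(2 * A b d) := by ring
      _ ≤ _ := this
      _ = p.ε₀ / 8 * A d d + 2 * p.ε₀ / p.τ₀ ^ 2 * ((τ ^ 2)⁻¹ * A b b) := by field_simp; ring
      _ ≤ p.ε₀ / 8 * A d d + 2 * p.ε₀ / p.τ₀ ^ 2 * (R / p.ε₀) := by linarith
      _ = _ := by field_simp
  set g := (2 * p.τ₀)⁻¹ • (h (n + 1) + h n) + -(p.μ₀⁻¹ • (L (e (n + 1)) + k (n + 1))) with hg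
  have hgn : ‖g‖ ^ 2 ≤ (2 / p.τ₀ ^ 2 + 2 * (4 * p.μ₀ + 2) / p.μ₀ ^ 2) * R := by
    have a1 := norm_add_sq_le ((2 * p.τ₀)⁻¹ • (h (n + 1) + h n))
      (-(p.μ₀⁻¹ • (L (e (n + 1)) + k (n + 1))))
    rw [norm_neg, norm_smul, norm_smul, mul_pow, mul_pow, Real.norm_of_nonneg (by positivity),
      Real.norm_of_nonneg (by positivity)] at a1
    have a2 : ‖h (n + 1) + h n‖ ^ 2 ≤ 4 * R := (norm_add_sq_le _ _).trans (by linarith)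
    have a3 : ‖L (e (n + 1)) + k (n + 1)‖ ^ 2 ≤ (4 * p.μ₀ + 2) * R :=
      (norm_add_sq_le _ _).trans (by linarith)
    refine a1.trans ?_
    calc _ ≤ 2 * ((2 * p.τ₀)⁻¹ ^ 2 * (4 * R)) + 2 * (p.μ₀⁻¹ ^ 2 * ((4 * p.μ₀ + 2) * R)) := by gcongr
      _ = _ := by field_simp; ring
  have T2 : inner ℝ g (L d) ≤ p.ε₀ / 8 * A d d
      + (2 * CL / p.ε₀) * ((2 / p.τ₀ ^ 2 + 2 * (4 * p.μ₀ + 2) / p.μ₀ ^ 2) * R) := by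
    have y := young_inner (s := 4 * CL / p.ε₀) (by positivity) g (L d)
    have y1 := mul_le_mul_of_nonneg_left hgn (by positivity : 0 ≤ 4 * CL / p.ε₀)
    have y2 := mul_le_mul_of_nonneg_left (hL d hdV) (by positivity : 0 ≤ (4 * CL / p.ε₀)⁻¹)
    have y3 : (4 * CL / p.ε₀)⁻¹ * (CL * A d d) = p.ε₀ / 4 * A d d := by field_simp
    have y4 : ∀ z, 4 * CL / p.ε₀ * z = 2 * (2 * CL / p.ε₀ * z) := fun z => by ring
    rw [y4 (_ * R)] at y1
    linarith
  have T3 : -(p.σ₀ / p.τ₀ * S (e (n + 1)) d) ≤ p.ε₀ / 8 * A d d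
      + 4 * CS * p.σ₀ / (p.ε₀ * p.τ₀) * R := by
    have y := neg_young_bilin hs.S_symm hs.S_nonneg (s := 4 * CS * p.σ₀ / (p.ε₀ * p.τ₀))
      (by positivity) (e (n + 1)) d
    have y1 := mul_le_mul_of_nonneg_left hSe
      (by positivity : 0 ≤ 4 * CS * p.σ₀ / (p.ε₀ * p.τ₀))
    have y2 := mul_le_mul_of_nonneg_left (hS d hdV)
      (by positivity : 0 ≤ (4 * CS * p.σ₀ / (p.ε₀ * p.τ₀))⁻¹)
    have y3 := mul_le_mul_of_nonneg_left (y.trans (add_le_add y1 y2))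
      (by positivity : 0 ≤ p.σ₀ / (2 * p.τ₀))
    calc _ = p.σ₀ / (2 * p.τ₀) * -(2 * S (e (n + 1)) d) := by ring
      _ ≤ _ := y3
      _ = _ := by field_simp; ring
  have hgi : inner ℝ g (L d) = 1 / p.τ₀ * (2⁻¹ * inner ℝ (h (n + 1) + h n) (L d))
      - 1 / p.μ₀ * inner ℝ (L (e (n + 1))) (L d) - 1 / p.μ₀ * inner ℝ (k (n + 1)) (L d) := by
    rw [hg, inner_add_left, inner_neg_left, real_inner_smul_left, real_inner_smul_left,
      inner_add_left (L (e (n + 1)))]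
    field_simp
    ring
  have e4 : A (d + (2 : ℝ) • b) d = A d d + 2 * A b d := by simp
  rw [← hd, e2, e4] at E
  have hP1 : A d d ≤ (τ ^ 2)⁻¹ * A d d := le_mul_of_one_le_left hAd hτ2
  have hP2 : 0 ≤ p.ε₀ / p.τ₀ * ((2 * τ)⁻¹ * A d d) := by positivity
  have hP3 := mul_le_mul_of_nonneg_left hP1 h1.le
  have hAd2 : A d d ≤ ((8 / (5 * p.ε₀)) * ((2 / p.τ₀ ^ 2) +
        (2 * CL / p.ε₀) * (2 / p.τ₀ ^ 2 + 2 * (4 * p.μ₀ + 2) / p.μ₀ ^ 2)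
        + 4 * CS * p.σ₀ / (p.ε₀ * p.τ₀))) * R := by
    have : 5 * p.ε₀ / 8 * A d d ≤ ((2 / p.τ₀ ^ 2) +
        (2 * CL / p.ε₀) * (2 / p.τ₀ ^ 2 + 2 * (4 * p.μ₀ + 2) / p.μ₀ ^ 2)
        + 4 * CS * p.σ₀ / (p.ε₀ * p.τ₀)) * R := by linarith
    have := mul_le_mul_of_nonneg_left this (by positivity : 0 ≤ 8 / (5 * p.ε₀))
    refine le_trans (le_of_eq ?_) (this.trans_eq ?_)
    · field_simp
    · ring
  have hAa : A (d + b) (d + b) ≤ KA * R := by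
    have y := bilin_add_le hs.A_symm hs.A_nonneg d b
    have y1 : A b b ≤ R / p.ε₀ := (le_mul_of_one_le_left hAb hτ2).trans hAbt
    rw [hKA]
    calc _ ≤ _ := y
      _ ≤ _ := add_le_add (mul_le_mul_of_nonneg_left hAd2 zero_le_two)
        (mul_le_mul_of_nonneg_left y1 zero_le_two)
      _ = _ := by ring
  have hAa0 := hs.A_nonneg (d + b)
  have habV : d + b ∈ V := V.add_mem hdV hbV
  have e3 : e (n + 2) = e (n + 1) + (d + b) := by rw [← e1]; abel
  have hc2 : ‖L (e (n + 2))‖ ^ 2 ≤ (4 * p.μ₀ + 2 * CL * KA) * R := by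
    have y := norm_add_sq_le (L (e (n + 1))) (L (d + b))
    rw [← map_add, ← e3] at y
    have y1 := (hL _ habV).trans (mul_le_mul_of_nonneg_left hAa hCL.le)
    linarith
  have hS2 : S (e (n + 2)) (e (n + 2)) ≤ (4 * p.τ₀ / p.σ₀ + 2 * CS * KA) * R := by
    have y := bilin_add_le hs.S_symm hs.S_nonneg (e (n + 1)) (d + b)
    rw [← e3] at y
    have y1 := (hS _ habV).trans (mul_le_mul_of_nonneg_left hAa hCS.le)
    have : 2 * (2 * p.τ₀ / p.σ₀ * R) = 4 * p.τ₀ / p.σ₀ * R := by ring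
    linarith
  unfold eng
  simp only [show n + 1 + 1 = n + 2 from rfl]
  rw [e1]
  have hcc : ‖L (e (n + 2))‖ ^ 2 + ‖L (e (n + 1))‖ ^ 2 ≤ (6 * p.μ₀ + 2 * CL * KA) * R := by linarith
  have hSS : S (e (n + 2)) (e (n + 2)) + S (e (n + 1)) (e (n + 1))
      ≤ (6 * p.τ₀ / p.σ₀ + 2 * CS * KA) * R := by
    have : 4 * p.τ₀ / p.σ₀ * R + 2 * p.τ₀ / p.σ₀ * R = 6 * p.τ₀ / p.σ₀ * R := by ring
    linarith
  -- The only place where the lower bound t ≤ τ enters.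
  have f1 : (τ ^ 2)⁻¹ * A (d + b) (d + b) ≤ (t ^ 2)⁻¹ * (KA * R) := by gcongr
  have f2 : τ / (4 * p.μ₀ * p.τ₀) * (‖L (e (n + 2))‖ ^ 2 + ‖L (e (n + 1))‖ ^ 2)
      ≤ 1 / (4 * p.μ₀ * p.τ₀) * ((6 * p.μ₀ + 2 * CL * KA) * R) := by gcongr
  calc _ ≤ p.ε₀ * ((t ^ 2)⁻¹ * (KA * R)) + 1 / (2 * p.μ₀) * ((6 * p.μ₀ + 2 * CL * KA) * R)
        + p.μ₀ * R + p.σ₀ / (2 * p.τ₀) * ((6 * p.τ₀ / p.σ₀ + 2 * CS * KA) * R)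
        + 1 / (4 * p.μ₀ * p.τ₀) * ((6 * p.μ₀ + 2 * CL * KA) * R) := by gcongr
    _ = _ := by ring

end

/-! ### Consequences of the time step restriction. -/

theorem curl_coeff_le {p : Params} {Cin H τ : ℝ} (hCin : 0 < Cin) (hτ : 0 < τ) (hH : 0 < H)
    (hc : τ ≤ H / (2 * Cin * p.Cv)) :
    1 / (2 * p.μ₀) * (Cin * H⁻¹) ^ 2 ≤ p.ε₀ / 8 * (τ ^ 2)⁻¹ := by
  have h1 := p.ε₀_pos
  have h2 := p.μ₀_pos
  -- The square of the restriction, with C_v² = 1/(ε₀μ₀).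
  have c1 : Cin ^ 2 * τ ^ 2 * 4 ≤ H ^ 2 * (p.ε₀ * p.μ₀) := by
    have hq : 0 < √(p.ε₀ * p.μ₀) := by positivity
    unfold Params.Cv at hc
    rw [le_div_iff₀ (by positivity)] at hc
    have : τ * (2 * Cin) ≤ H * √(p.ε₀ * p.μ₀) := by
      rw [← div_le_iff₀ hq]
      refine le_trans (le_of_eq ?_) hc
      ring
    have := pow_le_pow_left₀ (by positivity) this 2
    rw [mul_pow H, Real.sq_sqrt (by positivity)] at this
    linarith
  rw [← sub_nonneg]
  have : p.ε₀ / 8 * (τ ^ 2)⁻¹ - 1 / (2 * p.μ₀) * (Cin * H⁻¹) ^ 2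
      = (H ^ 2 * (p.ε₀ * p.μ₀) - Cin ^ 2 * τ ^ 2 * 4) / (8 * p.μ₀ * τ ^ 2 * H ^ 2) := by
    field_simp
    ring
  rw [this]
  exact div_nonneg (by linarith) (by positivity)

/-- The assumption is linear in H because the trace constant enters squared as Ctr²/H; the time step
restriction itself only supplies it with H² in place of H. -/
theorem sheet_coeff_le {p : Params} {Ctr H τ : ℝ} (hτ : 0 < τ) (hH : 0 < H)
    (hc : 4 * Ctr ^ 2 * p.σ₀ * τ ^ 2 ≤ H * (p.ε₀ * p.τ₀)) :
    p.σ₀ / (2 * p.τ₀) * (Ctr * (√H)⁻¹) ^ 2 ≤ p.ε₀ / 8 * (τ ^ 2)⁻¹ := by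
  have h3 := p.τ₀_pos
  rw [mul_pow, inv_pow, Real.sq_sqrt hH.le, ← sub_nonneg]
  have : p.ε₀ / 8 * (τ ^ 2)⁻¹ - p.σ₀ / (2 * p.τ₀) * (Ctr ^ 2 * H⁻¹)
      = (H * (p.ε₀ * p.τ₀) - 4 * Ctr ^ 2 * p.σ₀ * τ ^ 2) / (8 * p.τ₀ * τ ^ 2 * H) := by
    field_simp
    ring
  rw [this]
  exact div_nonneg (by linarith) (by positivity)

/-- If the time step is not small compared with the norm of the trace, then it is bounded from
below, and the mesh size is at least one. -/
theorem lower_bounds_of_large_step {p : Params} {Ctr H τ : ℝ} (hCtr : 0 < Ctr) (hτ : 0 < τ)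
    (hH : 0 < H) (hcS : τ ≤ H * √(p.ε₀ * p.τ₀) / (2 * Ctr * √p.σ₀))
    (hc : H * (p.ε₀ * p.τ₀) < 4 * Ctr ^ 2 * p.σ₀ * τ ^ 2) :
    1 ≤ H ∧ √(p.ε₀ * p.τ₀) / (2 * Ctr * √p.σ₀) ≤ τ := by
  have h1 := p.ε₀_pos
  have h3 := p.τ₀_pos
  have h4 := p.σ₀_pos
  have hcS' : 4 * Ctr ^ 2 * p.σ₀ * τ ^ 2 ≤ H ^ 2 * (p.ε₀ * p.τ₀) := by
    rw [le_div_iff₀ (by positivity)] at hcS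
    have := pow_le_pow_left₀ (by positivity) hcS 2
    rw [mul_pow H, Real.sq_sqrt (by positivity), mul_pow, mul_pow, mul_pow,
      Real.sq_sqrt h4.le] at this
    linarith
  have hH1 : 1 ≤ H := by
    by_contra! hlt
    have : H ^ 2 * (p.ε₀ * p.τ₀) ≤ H * (p.ε₀ * p.τ₀) := by
      have : H ^ 2 ≤ H := by nlinarith
      gcongr
    linarith
  refine ⟨hH1, ?_⟩
  rw [div_le_iff₀ (by positivity), Real.sqrt_le_left (by positivity)]
  rw [mul_pow, mul_pow, mul_pow, Real.sq_sqrt h4.le]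
  have : 1 * (p.ε₀ * p.τ₀) ≤ H * (p.ε₀ * p.τ₀) := by gcongr
  linarith

/-- Stability of the abstract leapfrog scheme, with a constant that depends only on the physical
parameters, the final time and the constants of the inverse estimate and the trace inequality. -/
theorem exists_energy_bound (p : Params) {T Cin Ctr : ℝ} (hT : 0 < T) (hCin : 0 < Cin)
    (hCtr : 0 < Ctr) : ∃ C : ℝ, 0 < C ∧
    ∀ (W Y : Type) [AddCommGroup W] [Module ℝ W] [NormedAddCommGroup Y] [InnerProductSpace ℝ Y]
      (τ H : ℝ) (M : ℕ) (A S : LinearMap.BilinForm ℝ W) (L : W →ₗ[ℝ] Y) (V : Submodule ℝ W)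
      (U : Submodule ℝ Y) (e : ℕ → W) (h k : ℕ → Y),
      0 < τ → 0 < H → M * τ ≤ T → CFL p Cin Ctr H τ →
      (∀ φ ∈ V, ‖L φ‖ ^ 2 ≤ (Cin * H⁻¹) ^ 2 * A φ φ) →
      (∀ φ ∈ V, S φ φ ≤ (Ctr * (√H)⁻¹) ^ 2 * A φ φ) →
      LeapfrogSystem p τ M A S L V U e h k →
      eng p τ A S L e h M ≤ C * data p τ A S L e h k M := by
  have h1 := p.ε₀_pos
  have h2 := p.μ₀_pos
  have h3 := p.τ₀_pos
  have h4 := p.σ₀_pos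
  -- All constants are fixed before the spaces, the mesh size and the time step are introduced, and
  -- kept as opaque variables. K1 serves the regime in which the sheet term can be absorbed, K2 the
  -- regime of large τ.
  obtain ⟨Kh, hKh, hKh0⟩ : ∃ Kh, Kh = 10 / p.μ₀ + 4 / p.μ₀ ^ 2 * (T * (3 + 12 * T)) ∧ 0 < Kh :=
    ⟨_, rfl, by positivity⟩
  obtain ⟨Kg, hKg, hKg0⟩ : ∃ Kg, Kg = ((2 + 9 / (2 * p.τ₀) + 1 / (2 * p.μ₀ * p.τ₀)
      + 1 / (2 * p.μ₀)) + (3 / p.τ₀ + 2)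
        + T * ((3 + 12 * T) / (p.μ₀ * p.τ₀)) + 1 / p.μ₀) ∧ 0 < Kg := ⟨_, rfl, by positivity⟩
  obtain ⟨t, ht, ht0⟩ : ∃ t, t = √(p.ε₀ * p.τ₀) / (2 * Ctr * √p.σ₀) ∧ 0 < t :=
    ⟨_, rfl, by positivity⟩
  obtain ⟨K1, hK1, hK10⟩ : ∃ K1, K1 = (2 + 1 / p.τ₀) * (Kg
        + 2 * p.μ₀ / p.τ₀ ^ 2 * (Kh + Kh) + 2 / p.μ₀ * ((3 + 12 * T) + (3 + 12 * T)))
      + p.μ₀ * Kh ∧ 0 < K1 := ⟨_, rfl, by positivity⟩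
  obtain ⟨KA, hKA, hKA0⟩ : ∃ KA, KA = 2 * ((8 / (5 * p.ε₀)) * ((2 / p.τ₀ ^ 2) +
        (2 * Cin ^ 2 / p.ε₀) * (2 / p.τ₀ ^ 2 + 2 * (4 * p.μ₀ + 2) / p.μ₀ ^ 2)
        + 4 * Ctr ^ 2 * p.σ₀ / (p.ε₀ * p.τ₀))) + 2 / p.ε₀ ∧ 0 < KA := ⟨_, rfl, by positivity⟩
  obtain ⟨KB, hKB, hKB0⟩ : ∃ KB, KB = (p.ε₀ * (t ^ 2)⁻¹ * KA
      + (1 / (2 * p.μ₀) + 1 / (4 * p.μ₀ * p.τ₀)) * (6 * p.μ₀ + 2 * Cin ^ 2 * KA)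
      + p.μ₀ + p.σ₀ / (2 * p.τ₀) * (6 * p.τ₀ / p.σ₀ + 2 * Ctr ^ 2 * KA)) ∧ 0 < KB :=
    ⟨_, rfl, by positivity⟩
  set K2 := KB * (1 / t + Kh + (3 + 12 * T)) with hK2
  have hK20 : 0 < K2 := by positivity
  -- The sum covers both regimes, and the summand 1 covers the initial energy.
  refine ⟨(1 + K1 + K2) * Real.exp ((1 + K1 + K2) * T), by positivity, ?_⟩
  intro W Y _ _ _ _ τ H M A S L V U e h k hτ hH hM hcfl hL hS hs
  unfold CFL at hcfl
  simp only [le_min_iff] at hcfl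
  obtain ⟨hτ1, hcL, hcS, -, -⟩ := hcfl
  obtain ⟨d1, d2, d0⟩ := hs.data_bounds hτ
  refine gronwall_sum (by positivity) d0 hτ.le hM (x := eng p τ A S L e h) ?_
  intro j hj
  have hx0 : ∀ i, 0 ≤ eng p τ A S L e h i := fun i => (hs.eng_bounds hτ i).2.2.2.2
  have hR : ∀ i, data p τ A S L e h k M ≤
      data p τ A S L e h k M + τ * ∑ i ∈ Finset.range i, eng p τ A S L e h i := fun i =>
    le_add_of_nonneg_right (mul_nonneg hτ.le (Finset.sum_nonneg fun i _ => hx0 i))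
  have hks : ∀ n ≤ M + 1, ‖k n‖ ^ 2 ≤ (3 + 12 * T) * data p τ A S L e h k M :=
    fun n hn => hs.source_bound hτ hM hn
  rcases j with _ | n
  · simp only [Finset.range_zero, Finset.sum_empty, mul_zero, add_zero]
    exact d1.trans (le_mul_of_one_le_left d0 (by linarith))
  have hn : n < M := hj
  have m1 := hs.magnetic_bound hτ hτ1 hM hj
  have m0 := hs.magnetic_bound hτ hτ1 hM hn.le
  have hR1 := hR (n + 1)
  have hRR : data p τ A S L e h k M + τ * ∑ i ∈ Finset.range n, eng p τ A S L e h i ≤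
      data p τ A S L e h k M + τ * ∑ i ∈ Finset.range (n + 1), eng p τ A S L e h i := by
    rw [Finset.sum_range_succ, mul_add]
    linarith [mul_nonneg hτ.le (hx0 n)]
  have hxR : τ * eng p τ A S L e h n ≤
      data p τ A S L e h k M + τ * ∑ i ∈ Finset.range (n + 1), eng p τ A S L e h i := by
    rw [Finset.sum_range_succ]
    linarith [hR n]
  have g1 := hs.corrected_bound hτ hτ1 hM hj
  rw [← hKh] at m1 m0
  rw [← hKg] at g1
  have k1 := hks (n + 1) (by omega)
  have k2 := hks (n + 2) (by omega)
  set F := data p τ A S L e h k M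
  set R := F + τ * ∑ i ∈ Finset.range (n + 1), eng p τ A S L e h i
  have hRnn : 0 ≤ R := d0.trans hR1
  have m0' : ‖h n‖ ^ 2 ≤ Kh * R := m0.trans (by gcongr)
  have k1' : ‖k (n + 1)‖ ^ 2 ≤ (3 + 12 * T) * R := k1.trans (by gcongr)
  have k2' : ‖k (n + 2)‖ ^ 2 ≤ (3 + 12 * T) * R := k2.trans (by gcongr)
  have hfin : eng p τ A S L e h (n + 1) ≤ K1 * R ∨ eng p τ A S L e h (n + 1) ≤ K2 * R := by
    by_cases hc : 4 * Ctr ^ 2 * p.σ₀ * τ ^ 2 ≤ H * (p.ε₀ * p.τ₀)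
    · left
      have hL' : ∀ φ ∈ V, 1 / (2 * p.μ₀) * ‖L φ‖ ^ 2 ≤ p.ε₀ / 8 * ((τ ^ 2)⁻¹ * A φ φ) := by
        intro φ hφ
        have hA := hs.A_nonneg φ
        have c2 := curl_coeff_le hCin hτ hH hcL
        calc _ ≤ 1 / (2 * p.μ₀) * ((Cin * H⁻¹) ^ 2 * A φ φ) := by gcongr; exact hL φ hφ
          _ = 1 / (2 * p.μ₀) * (Cin * H⁻¹) ^ 2 * A φ φ := by ring
          _ ≤ p.ε₀ / 8 * (τ ^ 2)⁻¹ * A φ φ := by gcongr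
          _ = _ := by ring
      have hS' : ∀ φ ∈ V, p.σ₀ / (2 * p.τ₀) * S φ φ ≤ p.ε₀ / 8 * ((τ ^ 2)⁻¹ * A φ φ) := by
        intro φ hφ
        have hA := hs.A_nonneg φ
        have c2 := sheet_coeff_le hτ hH hc
        calc _ ≤ p.σ₀ / (2 * p.τ₀) * ((Ctr * (√H)⁻¹) ^ 2 * A φ φ) := by gcongr; exact hS φ hφ
          _ = p.σ₀ / (2 * p.τ₀) * (Ctr * (√H)⁻¹) ^ 2 * A φ φ := by ring
          _ ≤ p.ε₀ / 8 * (τ ^ 2)⁻¹ * A φ φ := by gcongr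
          _ = _ := by ring
      refine (hs.eng_le_corrected hτ hτ1 hL' hS' hn).trans ?_
      calc _ ≤ (2 + 1 / p.τ₀) * (Kg * R + 2 * p.μ₀ / p.τ₀ ^ 2 * (Kh * R + Kh * R)
            + 2 / p.μ₀ * ((3 + 12 * T) * R + (3 + 12 * T) * R)) + p.μ₀ * (Kh * R) := by gcongr
        _ = _ := by rw [hK1]; ring
    · right
      push Not at hc
      obtain ⟨hH1, htτ⟩ := lower_bounds_of_large_step hCtr hτ hH hcS hc
      rw [← ht] at htτ
      have hLb : ∀ φ ∈ V, ‖L φ‖ ^ 2 ≤ Cin ^ 2 * A φ φ := by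
        intro φ hφ
        have hA := hs.A_nonneg φ
        have : Cin * H⁻¹ ≤ Cin := mul_le_of_le_one_right hCin.le (inv_le_one_of_one_le₀ hH1)
        exact (hL φ hφ).trans (by gcongr)
      have hSb : ∀ φ ∈ V, S φ φ ≤ Ctr ^ 2 * A φ φ := by
        intro φ hφ
        have hA := hs.A_nonneg φ
        have : Ctr * (√H)⁻¹ ≤ Ctr :=
          mul_le_of_le_one_right hCtr.le (inv_le_one_of_one_le₀ (Real.one_le_sqrt.2 hH1))
        exact (hS φ hφ).trans (by gcongr)
      -- As τ ≥ t, the previous energy is controlled by its own term in the Gronwall sum, so the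
      -- crude one-step factor is not iterated.
      have hx : eng p τ A S L e h n ≤ 1 / t * R := by
        rw [one_div, le_inv_mul_iff₀ ht0]
        exact (mul_le_mul_of_nonneg_right htτ (hx0 n)).trans hxR
      have s1 : 0 ≤ 1 / t * R := by positivity
      have s2 : 0 ≤ Kh * R := by positivity
      have s3 : 0 ≤ (3 + 12 * T) * R := by positivity
      have := hs.eng_succ_le hτ hτ1 ht0 htτ (by positivity) (by positivity) hLb hSb hn
        (R := (1 / t + Kh + (3 + 12 * T)) * R)
        (by rw [add_mul, add_mul]; linarith only [hx, s1, s2, s3])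
        (by rw [add_mul, add_mul]; linarith only [m0', s1, s2, s3])
        (by rw [add_mul, add_mul]; linarith only [m1, s1, s2, s3])
        (by rw [add_mul, add_mul]; linarith only [k1', s1, s2, s3]) KA hKA
      rw [← hKB] at this
      exact this.trans_eq (by rw [hK2]; ring)
  have hp1 : 0 ≤ K1 * R := by positivity
  have hp2 : 0 ≤ K2 * R := by positivity
  rw [add_mul, add_mul, one_mul]
  rcases hfin with hf | hf
  · linarith only [hf, hp2, hRnn]
  · linarith only [hf, hp1, hRnn]

end LeapfrogSystem

/-! ### Values of polynomials -/

section EvalAt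

variable (x : Plane)

@[simp] theorem evalAt_zero : evalAt x 0 = 0 := map_zero _
@[simp] theorem evalAt_add (p q : Poly) : evalAt x (p + q) = evalAt x p + evalAt x q := map_add _ _ _
@[simp] theorem evalAt_sub (p q : Poly) : evalAt x (p - q) = evalAt x p - evalAt x q := map_sub _ _ _
@[simp] theorem evalAt_smul (a : ℝ) (p : Poly) : evalAt x (a • p) = a * evalAt x p :=
  MvPolynomial.smul_eval _ _ _

/-- The value of a polynomial at a point, as a linear map. -/
def evalLin : Poly →ₗ[ℝ] ℝ where
  toFun := evalAt x
  map_add' := evalAt_add x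
  map_smul' := evalAt_smul x

theorem evalLin_apply (p : Poly) : evalLin x p = evalAt x p := rfl

theorem continuous_evalAt (p : Poly) : Continuous fun x => evalAt x p := by
  unfold evalAt
  exact (MvPolynomial.continuous_eval p).comp (by fun_prop)

end EvalAt

theorem memLp_evalAt {s : Set Plane} (hb : Bornology.IsBounded s) (hm : MeasurableSet s)
    (p : Poly) : MemLp (fun x => evalAt x p) 2 (volume.restrict s) := by
  have : IsFiniteMeasure (volume.restrict s : Measure Plane) :=
    ⟨by simpa using hb.measure_lt_top⟩
  obtain ⟨C, hC⟩ := hb.isCompact_closure.exists_bound_of_continuousOn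
    (continuous_evalAt p).continuousOn
  refine MemLp.of_bound (continuous_evalAt p).aestronglyMeasurable C ?_
  filter_upwards [ae_restrict_mem hm] with x hx using hC x (subset_closure hx)

theorem inner_toLp {α : Type*} [MeasurableSpace α] {μ : Measure α} {f g : α → ℝ}
    (hf : MemLp f 2 μ) (hg : MemLp g 2 μ) :
    inner ℝ (hf.toLp f) (hg.toLp g) = ∫ x, f x * g x ∂μ := by
  rw [L2.inner_def]
  refine integral_congr_ae ?_
  filter_upwards [hf.coeFn_toLp, hg.coeFn_toLp] with x h1 h2
  rw [h1, h2]
  simp [mul_comm]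

theorem norm_toLp_sq {α : Type*} [MeasurableSpace α] {μ : Measure α} {f : α → ℝ}
    (hf : MemLp f 2 μ) : ‖hf.toLp f‖ ^ 2 = ∫ x, f x ^ 2 ∂μ := by
  rw [← real_inner_self_eq_norm_sq, inner_toLp]
  simp only [sq]

/-- Continuity removes the exceptional null set. The disc contains a product of two intervals, and a
polynomial that vanishes on a product of infinite sets is zero. -/
theorem eq_zero_of_ae_ball {ρ : ℝ} (hρ : 0 < ρ) {p : Poly}
    (h : ∀ᵐ x ∂(volume.restrict (Metric.ball (0 : Plane) ρ)), evalAt x p = 0) : p = 0 := by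
  have h1 : Set.EqOn (fun x => evalAt x p) 0 (Metric.ball (0 : Plane) ρ) :=
    Measure.eqOn_open_of_ae_eq h Metric.isOpen_ball (continuous_evalAt p).continuousOn
      continuousOn_const
  refine MvPolynomial.funext_set (fun _ => Set.Ioo (-(ρ / 2)) (ρ / 2))
    (fun _ => Set.Ioo_infinite (by linarith)) fun y hy => ?_
  rw [map_zero]
  refine h1 (x := WithLp.toLp 2 y) ?_
  have hy0 := hy 0 (Set.mem_univ _)
  have hy1 := hy 1 (Set.mem_univ _)
  simp only [Set.mem_Ioo] at hy0 hy1
  rw [mem_ball_zero_iff]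
  refine lt_of_pow_lt_pow_left₀ 2 hρ.le ?_
  rw [EuclideanSpace.norm_sq_eq]
  simp only [Fin.sum_univ_two, Real.norm_eq_abs, sq_abs]
  nlinarith

/-- Polynomials of bounded degree, and the results of applying a linear operator to them, are
bounded on the unit disc by their mean square on a concentric disc. -/
theorem exists_sq_evalAt_le (r : ℕ) {ρ : ℝ} (hρ : 0 < ρ) (D : Poly →ₗ[ℝ] Poly) :
    ∃ C : ℝ, 0 < C ∧ ∀ p ∈ MvPolynomial.restrictTotalDegree (Fin 2) ℝ r,
      ∀ x ∈ Metric.closedBall (0 : Plane) 1,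
        evalAt x (D p) ^ 2 ≤ C * ∫ y in Metric.ball (0 : Plane) ρ, evalAt y p ^ 2 := by
  let b := Module.finBasis ℝ (MvPolynomial.restrictTotalDegree (Fin 2) ℝ r)
  let B := Metric.ball (0 : Plane) ρ
  have hB : ∀ p, MemLp (fun x => evalAt x p) 2 (volume.restrict B) := fun p =>
    memLp_evalAt Metric.isBounded_ball measurableSet_ball p
  let J : Poly →ₗ[ℝ] Lp ℝ 2 (volume.restrict B) :=
    { toFun := fun p => (hB p).toLp _
      map_add' := fun p q => by
        rw [← MemLp.toLp_add]
        congr 1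
        ext x
        simp
      map_smul' := fun a p => by
        rw [RingHom.id_apply, ← MemLp.toLp_const_smul]
        congr 1
        ext x
        simp }
  let Lc := Fintype.linearCombination ℝ (fun i => ((b i : Poly)))
  -- Injectivity on a finite-dimensional space gives an antilipschitz constant: the coefficients in
  -- a basis are bounded by the L² norm on the small disc.
  have hker : LinearMap.ker (J ∘ₗ Lc) = ⊥ := by
    rw [LinearMap.ker_eq_bot']
    intro a ha
    have h1 : (fun x => evalAt x (Lc a)) =ᵐ[volume.restrict B] 0 := by
      have h2 := (hB (Lc a)).coeFn_toLp
      have h3 : (hB (Lc a)).toLp _ = 0 := ha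
      rw [h3] at h2
      exact h2.symm.trans (Lp.coeFn_zero _ _ _)
    have h4 : Lc a = 0 := eq_zero_of_ae_ball hρ h1
    have h5 : ∑ i, a i • b i = 0 := by
      apply Subtype.ext
      simpa [Lc, Fintype.linearCombination_apply] using h4
    ext i
    exact Fintype.linearIndependent_iff.1 b.linearIndependent a h5 i
  obtain ⟨K, hK0, hK⟩ := (J ∘ₗ Lc).exists_antilipschitzWith hker
  have hbd : ∀ i, ∃ c, ∀ x ∈ Metric.closedBall (0 : Plane) 1, ‖evalAt x (D (b i))‖ ≤ c := fun i =>
    (isCompact_closedBall _ _).exists_bound_of_continuousOn (continuous_evalAt _).continuousOn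
  choose c hc using hbd
  have hc0 : ∀ i, 0 ≤ c i := fun i =>
    (norm_nonneg _).trans (hc i 0 (Metric.mem_closedBall_self zero_le_one))
  have hs0 : 0 ≤ ∑ i, c i := Finset.sum_nonneg fun i _ => hc0 i
  -- The added 1 only secures positivity.
  refine ⟨(K * ∑ i, c i) ^ 2 + 1, by positivity, fun p hp x hx => ?_⟩
  have hI : 0 ≤ ∫ y in B, evalAt y p ^ 2 := integral_nonneg fun _ => sq_nonneg _
  set a : Fin _ → ℝ := fun i => b.repr ⟨p, hp⟩ i with ha
  have hpa : Lc a = p := by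
    have h := congrArg Subtype.val (b.sum_repr ⟨p, hp⟩)
    simp only [AddSubmonoidClass.coe_finsetSum, SetLike.val_smul] at h
    rw [Fintype.linearCombination_apply]
    exact h
  have hna : ‖a‖ ≤ K * ‖(hB p).toLp _‖ := by
    have h := hK.le_mul_dist a 0
    rw [map_zero, dist_zero_right, dist_zero_right] at h
    change ‖a‖ ≤ K * ‖J (Lc a)‖ at h
    rw [hpa] at h
    exact h
  have hval : |evalAt x (D p)| ≤ (∑ i, c i) * ‖a‖ := by
    have h1 : evalAt x (D p) = ∑ i, a i * evalAt x (D (b i)) := by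
      rw [← hpa, Fintype.linearCombination_apply, map_sum, ← evalLin_apply, map_sum]
      simp [evalLin_apply]
    rw [h1, Finset.sum_mul]
    refine (Finset.abs_sum_le_sum_abs _ _).trans (Finset.sum_le_sum fun i _ => ?_)
    rw [abs_mul, mul_comm]
    exact mul_le_mul (hc i x hx) (norm_le_pi_norm a i) (abs_nonneg _) (hc0 i)
  have h2 : |evalAt x (D p)| ≤ (K * ∑ i, c i) * ‖(hB p).toLp _‖ := by
    refine hval.trans ((mul_le_mul_of_nonneg_left hna hs0).trans_eq (by ring))
  calc evalAt x (D p) ^ 2 = |evalAt x (D p)| ^ 2 := (sq_abs _).symm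
    _ ≤ ((K * ∑ i, c i) * ‖(hB p).toLp _‖) ^ 2 := by gcongr
    _ = (K * ∑ i, c i) ^ 2 * ∫ y in B, evalAt y p ^ 2 := by rw [mul_pow, norm_toLp_sq]
    _ ≤ _ := by gcongr; linarith

/-! ### Scaling -/

/-- The polynomial `y ↦ p (c + h y)`. -/
def rescale (c : Plane) (h : ℝ) : Poly →ₐ[ℝ] Poly :=
  MvPolynomial.aeval fun i => MvPolynomial.C (c i) + MvPolynomial.C h * MvPolynomial.X i

theorem evalAt_rescale (c : Plane) (h : ℝ) (y : Plane) (p : Poly) :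
    evalAt y (rescale c h p) = evalAt (c + h • y) p := by
  unfold evalAt rescale
  induction p using MvPolynomial.induction_on with
  | C a => simp
  | add p q hp hq => simp only [map_add, hp, hq]
  | mul_X p i hp => simp only [map_mul, hp]; simp

theorem pderiv_rescale (c : Plane) (h : ℝ) (j : Fin 2) (p : Poly) :
    MvPolynomial.pderiv j (rescale c h p) = h • rescale c h (MvPolynomial.pderiv j p) := by
  unfold rescale
  induction p using MvPolynomial.induction_on with
  | C a => simp
  | add p q hp hq => simp only [map_add, hp, hq, smul_add]
  | mul_X p i hp =>
    simp only [map_mul, Derivation.leibniz, hp, MvPolynomial.aeval_X, MvPolynomial.pderiv_X, map_add,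
      MvPolynomial.pderiv_C, smul_eq_mul, zero_add, mul_zero, add_zero]
    rcases eq_or_ne i j with rfl | hij
    · simp [MvPolynomial.smul_eq_C_mul]; ring
    · simp [MvPolynomial.smul_eq_C_mul, hij.symm]; ring

theorem totalDegree_rescale_le (c : Plane) (h : ℝ) (p : Poly) :
    (rescale c h p).totalDegree ≤ p.totalDegree := by
  unfold rescale
  rw [MvPolynomial.aeval_def, MvPolynomial.eval₂_eq']
  refine MvPolynomial.totalDegree_finsetSum_le fun d hd => ?_
  refine (MvPolynomial.totalDegree_mul _ _).trans ?_
  rw [MvPolynomial.algebraMap_eq, MvPolynomial.totalDegree_C, zero_add]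
  refine (MvPolynomial.totalDegree_finsetProd _ _).trans ?_
  refine le_trans (Finset.sum_le_sum (g := fun i => d i) fun i _ => ?_) ?_
  · refine (MvPolynomial.totalDegree_pow _ _).trans ?_
    refine (Nat.mul_le_mul_left _ (?_ : _ ≤ 1)).trans_eq (mul_one _)
    refine (MvPolynomial.totalDegree_add _ _).trans (max_le (by simp) ?_)
    refine (MvPolynomial.totalDegree_mul _ _).trans ?_
    simp
  · have := MvPolynomial.le_totalDegree hd
    rwa [Finsupp.sum_fintype _ _ (by simp)] at this

theorem setIntegral_rescale (c : Plane) {h : ℝ} (hh : 0 < h) (ρ : ℝ) (f : Plane → ℝ) :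
    ∫ y in Metric.ball (0 : Plane) ρ, f (c + h • y)
      = (h ^ 2)⁻¹ * ∫ y in Metric.ball c (h * ρ), f y := by
  have h1 := Measure.setIntegral_comp_smul_of_pos volume (fun y => f (c + y))
    (Metric.ball (0 : Plane) ρ) hh
  rw [h1, smul_ball hh.ne', smul_zero, Real.norm_of_nonneg hh.le, finrank_euclideanSpace_fin,
    smul_eq_mul]
  congr 1
  have h2 := (measurePreserving_add_left volume c).setIntegral_preimage_emb
    (MeasurableEquiv.addLeft c).measurableEmbedding f (Metric.ball c (h * ρ))
  rw [← h2]
  congr 2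
  ext y
  simp

/-- The substitution x = c + h y carries the discs of radii 1 and 1/κ to those of radii h and h/κ
and preserves the degree bound. The area element gives h⁻², and the square of a first derivative
gives another h⁻². -/
theorem exists_sq_evalAt_le_scaled (r : ℕ) {κ : ℝ} (hκ : 0 < κ) :
    ∃ C : ℝ, 0 < C ∧ ∀ p ∈ MvPolynomial.restrictTotalDegree (Fin 2) ℝ r, ∀ (c : Plane) (h : ℝ),
      0 < h → ∀ x ∈ Metric.closedBall c h,
        evalAt x p ^ 2 ≤ C * (h ^ 2)⁻¹ * ∫ y in Metric.ball c (h / κ), evalAt y p ^ 2 ∧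
        ∀ j, evalAt x (MvPolynomial.pderiv j p) ^ 2
          ≤ C * (h ^ 4)⁻¹ * ∫ y in Metric.ball c (h / κ), evalAt y p ^ 2 := by
  have hκ' : 0 < 1 / κ := by positivity
  obtain ⟨C, hC0, hC⟩ := exists_sq_evalAt_le r hκ' LinearMap.id
  have hd := fun j => exists_sq_evalAt_le r hκ' (MvPolynomial.pderiv (R := ℝ) (σ := Fin 2) j).toLinearMap
  choose D hD0 hD using hd
  refine ⟨C + (D 0 + D 1), by linarith [hD0 0, hD0 1], fun p hp c h hh x hx => ?_⟩
  set I := ∫ y in Metric.ball c (h / κ), evalAt y p ^ 2 with hI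
  have hI0 : 0 ≤ I := integral_nonneg fun _ => sq_nonneg _
  have hp' : rescale c h p ∈ MvPolynomial.restrictTotalDegree (Fin 2) ℝ r := by
    rw [MvPolynomial.mem_restrictTotalDegree] at hp ⊢
    exact (totalDegree_rescale_le c h p).trans hp
  set y := h⁻¹ • (x - c) with hy
  have hxy : c + h • y = x := by rw [hy, smul_inv_smul₀ hh.ne']; abel
  have hyB : y ∈ Metric.closedBall (0 : Plane) 1 := by
    rw [mem_closedBall_zero_iff, hy, norm_smul, norm_inv, Real.norm_of_nonneg hh.le,
      inv_mul_le_iff₀ hh, mul_one, ← dist_eq_norm]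
    exact hx
  have hint : ∫ z in Metric.ball (0 : Plane) (1 / κ), evalAt z (rescale c h p) ^ 2
      = (h ^ 2)⁻¹ * I := by
    simp_rw [evalAt_rescale]
    rw [setIntegral_rescale c hh (1 / κ) fun z => evalAt z p ^ 2, hI, mul_one_div]
  constructor
  · have h1 := hC _ hp' y hyB
    rw [LinearMap.id_apply, hint, evalAt_rescale, hxy] at h1
    calc _ ≤ _ := h1
      _ = C * (h ^ 2)⁻¹ * I := by ring
      _ ≤ _ := by gcongr; linarith [hD0 0, hD0 1]
  · intro j
    have h1 := hD j _ hp' y hyB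
    rw [hint] at h1
    change evalAt y (MvPolynomial.pderiv j (rescale c h p)) ^ 2 ≤ _ at h1
    rw [pderiv_rescale, evalAt_smul, evalAt_rescale, hxy] at h1
    have h2 : evalAt x (MvPolynomial.pderiv j p) ^ 2 ≤ D j * (h ^ 4)⁻¹ * I := by
      have h3 := mul_le_mul_of_nonneg_left h1 (by positivity : 0 ≤ (h ^ 2)⁻¹)
      refine le_trans (le_of_eq ?_) (h3.trans_eq ?_)
      · field_simp
      · field_simp
    refine h2.trans ?_
    have h4 : D j ≤ C + (D 0 + D 1) := by
      fin_cases j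
      · change D 0 ≤ _; linarith [hD0 1]
      · change D 1 ≤ _; linarith [hD0 0]
    gcongr

/-! ### The local space -/

theorem totalDegree_pderiv_le (j : Fin 2) (p : Poly) :
    (MvPolynomial.pderiv j p).totalDegree ≤ p.totalDegree - 1 := by
  conv_lhs => rw [← MvPolynomial.support_sum_monomial_coeff p, map_sum]
  refine MvPolynomial.totalDegree_finsetSum_le fun d hd => ?_
  have h1 : (MvPolynomial.monomial d (p.coeff d)).IsHomogeneous d.degree :=
    MvPolynomial.isHomogeneous_monomial _ rfl
  refine (h1.pderiv (i := j)).totalDegree_le.trans (Nat.sub_le_sub_right ?_ 1)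
  have := MvPolynomial.le_totalDegree hd
  rwa [Finsupp.sum_fintype _ _ (by simp), ← Finsupp.degree_eq_sum] at this

/-- For the inverse and trace estimates the local space matters only through this degree bound. -/
theorem nedelec_mem {r : ℕ} {v : Fin 2 → Poly} (hv : v ∈ nedelec r) (i : Fin 2) :
    v i ∈ MvPolynomial.restrictTotalDegree (Fin 2) ℝ r := by
  obtain ⟨q, s, rfl, hq, hs, -⟩ := hv
  refine Submodule.add_mem _ ?_ ?_
  · have := hq i
    rw [MvPolynomial.mem_restrictTotalDegree] at this ⊢
    omega
  · rw [MvPolynomial.mem_restrictTotalDegree]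
    exact MvPolynomial.IsHomogeneous.totalDegree_le (hs i)

theorem pderiv_nedelec_mem {r : ℕ} {v : Fin 2 → Poly} (hv : v ∈ nedelec r) (i j : Fin 2) :
    MvPolynomial.pderiv j (v i) ∈ MvPolynomial.restrictTotalDegree (Fin 2) ℝ (r - 1) := by
  have := nedelec_mem hv i
  rw [MvPolynomial.mem_restrictTotalDegree] at this ⊢
  have := totalDegree_pderiv_le j (v i)
  omega

theorem nedelec_add {r : ℕ} {u v : Fin 2 → Poly} (hu : u ∈ nedelec r) (hv : v ∈ nedelec r) :
    u + v ∈ nedelec r := by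
  obtain ⟨q, s, rfl, hq, hs, h0⟩ := hu
  obtain ⟨q', s', rfl, hq', hs', h0'⟩ := hv
  refine ⟨q + q', s + s', by abel, fun i => Submodule.add_mem _ (hq i) (hq' i),
    fun i => Submodule.add_mem _ (hs i) (hs' i), ?_⟩
  simp only [Pi.add_apply]
  linear_combination h0 + h0'

theorem nedelec_smul {r : ℕ} {u : Fin 2 → Poly} (a : ℝ) (hu : u ∈ nedelec r) :
    a • u ∈ nedelec r := by
  obtain ⟨q, s, rfl, hq, hs, h0⟩ := hu
  refine ⟨a • q, a • s, smul_add _ _ _, fun i => Submodule.smul_mem _ a (hq i),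
    fun i => Submodule.smul_mem _ a (hs i), ?_⟩
  simp only [Pi.smul_apply, mul_smul_comm, ← smul_add, h0, smul_zero]

/-! ### The weak curl is linear -/

section WeakCurl

variable {Ω : Set Plane} {u u' : Plane → Fin 2 → ℝ} {w w' : Plane → ℝ}

theorem integrable_mul_pd {f φ : Plane → ℝ} (hf : MemLp f 2 (volume.restrict Ω))
    (hφ : ContDiff ℝ ∞ φ) (hc : HasCompactSupport φ) (i : Fin 2) :
    Integrable (fun x => f x * pd i φ x) (volume.restrict Ω) := by
  have h1 : Continuous (pd i φ) := by
    unfold pd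
    exact (hφ.continuous_fderiv (by simp)).clm_apply continuous_const
  have h2 : HasCompactSupport (pd i φ) := hc.fderiv_apply ℝ _
  exact hf.integrable_mul (h1.memLp_of_hasCompactSupport (p := 2) h2)

theorem integrable_mul_test {f φ : Plane → ℝ} (hf : MemLp f 2 (volume.restrict Ω))
    (hφ : ContDiff ℝ ∞ φ) (hc : HasCompactSupport φ) :
    Integrable (fun x => f x * φ x) (volume.restrict Ω) :=
  hf.integrable_mul (hφ.continuous.memLp_of_hasCompactSupport (p := 2) hc)

theorem HasWeakCurl.add (h : HasWeakCurl Ω u w) (h' : HasWeakCurl Ω u' w') :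
    HasWeakCurl Ω (fun x i => u x i + u' x i) (fun x => w x + w' x) where
  memLp_field i := (h.memLp_field i).add (h'.memLp_field i)
  memLp_curl := h.memLp_curl.add h'.memLp_curl
  integral_eq φ hφ hc hs := by
    have e1 := h.integral_eq φ hφ hc hs
    have e2 := h'.integral_eq φ hφ hc hs
    have i1 := (integrable_mul_pd (h.memLp_field 0) hφ hc 1).sub
      (integrable_mul_pd (h.memLp_field 1) hφ hc 0)
    have i2 := (integrable_mul_pd (h'.memLp_field 0) hφ hc 1).sub
      (integrable_mul_pd (h'.memLp_field 1) hφ hc 0)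
    simp_rw [add_mul]
    rw [integral_add (integrable_mul_test h.memLp_curl hφ hc)
      (integrable_mul_test h'.memLp_curl hφ hc), ← e1, ← e2]
    refine Eq.trans ?_ (integral_add i1 i2)
    congr 1
    ext x
    ring

theorem HasWeakCurl.const_mul (a : ℝ) (h : HasWeakCurl Ω u w) :
    HasWeakCurl Ω (fun x i => a * u x i) (fun x => a * w x) where
  memLp_field i := (h.memLp_field i).const_mul a
  memLp_curl := h.memLp_curl.const_mul a
  integral_eq φ hφ hc hs := by
    simp_rw [mul_assoc]
    rw [integral_const_mul, ← h.integral_eq φ hφ hc hs, ← integral_const_mul]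
    congr 1
    ext x
    ring

end WeakCurl

theorem cross_add (a b : Fin 2 → ℝ) (n : Plane) :
    cross (fun i => a i + b i) n = cross a n + cross b n := by
  unfold cross; ring

theorem cross_smul (c : ℝ) (a : Fin 2 → ℝ) (n : Plane) :
    cross (fun i => c * a i) n = c * cross a n := by
  unfold cross; ring

theorem isCompact_hull (s : Finset Plane) : IsCompact (hull s) :=
  s.finite_toSet.isCompact_convexHull ℝ

theorem hull_pair (a b : Plane) : hull {a, b} = segment ℝ a b := by
  simp [hull, convexHull_pair]

namespace TriMesh

variable {Ω Γ : Set Plane} (M : TriMesh Ω Γ)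

/-! ### Piecewise polynomials as elements of `L²(Ω)` -/

theorem fn_add (u v : M.PScalar) (x : Plane) : M.fn (u + v) x = M.fn u x + M.fn v x := by
  unfold fn
  rw [← Finset.sum_add_distrib]
  refine Finset.sum_congr rfl fun t _ => ?_
  by_cases hx : x ∈ interior (hull (t : Finset Plane)) <;> simp [hx]

theorem fn_smul (a : ℝ) (u : M.PScalar) (x : Plane) : M.fn (a • u) x = a * M.fn u x := by
  unfold fn
  rw [Finset.mul_sum]
  refine Finset.sum_congr rfl fun t _ => ?_
  by_cases hx : x ∈ interior (hull (t : Finset Plane)) <;> simp [hx]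

theorem memLp_fn (u : M.PScalar) : MemLp (M.fn u) 2 (volume.restrict Ω) := by
  have : M.fn u = fun x => ∑ t : M.triangles,
      (interior (hull (t : Finset Plane))).indicator (fun y => evalAt y (u t)) x := rfl
  rw [this]
  refine memLp_finsetSum _ fun t _ => ?_
  have hm : MeasurableSet (interior (hull (t : Finset Plane))) := isOpen_interior.measurableSet
  refine MemLp.restrict Ω ?_
  rw [memLp_indicator_iff_restrict hm]
  exact memLp_evalAt ((isCompact_hull _).isBounded.subset _root_.interior_subset) hm _

/-- The class in `L²(Ω)` of a piecewise polynomial. -/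
def toL2 : M.PScalar →ₗ[ℝ] Lp ℝ 2 (volume.restrict Ω) where
  toFun u := (M.memLp_fn u).toLp _
  map_add' u v := by
    rw [← MemLp.toLp_add]
    congr 1
    ext x
    exact M.fn_add u v x
  map_smul' a u := by
    rw [RingHom.id_apply, ← MemLp.toLp_const_smul]
    congr 1
    ext x
    exact M.fn_smul a u x

theorem inner_toL2 (u v : M.PScalar) :
    inner ℝ (M.toL2 u) (M.toL2 v) = ip Ω (M.fn u) (M.fn v) :=
  inner_toLp (M.memLp_fn u) (M.memLp_fn v)

theorem norm_toL2_sq (u : M.PScalar) : ‖M.toL2 u‖ ^ 2 = nrm Ω (M.fn u) ^ 2 := by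
  rw [← real_inner_self_eq_norm_sq, inner_toL2, nrm, Real.sq_sqrt]
  exact integral_nonneg fun x => mul_self_nonneg _

/-- A component of a piecewise polynomial vector field. -/
def comp (i : Fin 2) : M.PVector →ₗ[ℝ] M.PScalar where
  toFun v t := v t i
  map_add' _ _ := rfl
  map_smul' _ _ := rfl

/-- The piecewise curl, as a linear map. -/
def curlLin : M.PVector →ₗ[ℝ] M.PScalar where
  toFun := M.curl
  map_add' u v := by
    funext t
    simp only [curl, Pi.add_apply, map_add]
    ring
  map_smul' a u := by
    funext t
    simp only [curl, Pi.smul_apply, Derivation.map_smul, RingHom.id_apply, smul_sub]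

/-- The curl as an element of `L²(Ω)`. -/
def curlL2 : M.PVector →ₗ[ℝ] Lp ℝ 2 (volume.restrict Ω) := M.toL2 ∘ₗ M.curlLin

theorem curlL2_apply (v : M.PVector) : M.curlL2 v = M.toL2 (M.curl v) := rfl

/-- The `L²(Ω)` inner product of piecewise polynomial vector fields. -/
def fieldForm : LinearMap.BilinForm ℝ M.PVector :=
  ∑ i, (innerₗ (Lp ℝ 2 (volume.restrict Ω))).compl₁₂ (M.toL2 ∘ₗ M.comp i) (M.toL2 ∘ₗ M.comp i)

theorem fieldForm_eq_sum (u v : M.PVector) :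
    M.fieldForm u v = ∑ i, inner ℝ (M.toL2 (M.comp i u)) (M.toL2 (M.comp i v)) := by
  simp [fieldForm]

theorem fieldForm_apply (u v : M.PVector) : M.fieldForm u v = ipV Ω (M.fnV u) (M.fnV v) := by
  rw [fieldForm_eq_sum]
  unfold ipV
  rw [integral_finsetSum]
  · exact Finset.sum_congr rfl fun i _ => M.inner_toL2 _ _
  · exact fun i _ => (M.memLp_fn (M.comp i u)).integrable_mul (M.memLp_fn (M.comp i v))

theorem fieldForm_symm (u v : M.PVector) : M.fieldForm u v = M.fieldForm v u := by
  rw [fieldForm_eq_sum, fieldForm_eq_sum]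
  exact Finset.sum_congr rfl fun i _ => real_inner_comm _ _

theorem fieldForm_nonneg (u : M.PVector) : 0 ≤ M.fieldForm u u := by
  rw [fieldForm_eq_sum]
  exact Finset.sum_nonneg fun i _ => real_inner_self_nonneg

theorem nrmV_sq (u : M.PVector) : nrmV Ω (M.fnV u) ^ 2 = M.fieldForm u u := by
  rw [nrmV, ← fieldForm_apply, Real.sq_sqrt (M.fieldForm_nonneg u)]

/-! ### The sheet -/

theorem exists_of_mem_sheetEdges {e : Finset Plane} (he : e ∈ M.sheetEdges) :
    ∃ t ∈ M.triangles, e ⊆ t ∧ e.card = 2 := by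
  classical
  unfold sheetEdges at he
  simp only [Finset.mem_filter, Finset.mem_biUnion, Finset.mem_powersetCard] at he
  obtain ⟨⟨t, ht, he1, he2⟩, -⟩ := he
  exact ⟨t, ht, he1, he2⟩

theorem hausdorffMeasure_hull_lt_top {e : Finset Plane} (he : e.card = 2) :
    Measure.hausdorffMeasure 1 (hull e) < ⊤ := by
  obtain ⟨a, b, -, rfl⟩ := Finset.card_eq_two.1 he
  rw [hull_pair, hausdorffMeasure_segment]
  exact edist_lt_top a b

theorem integrableOn_hull {e : Finset Plane} (he : e.card = 2) {f : Plane → ℝ}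
    (hf : Continuous f) : IntegrableOn f (hull e) (Measure.hausdorffMeasure 1) := by
  obtain ⟨C, hC⟩ := (isCompact_hull e).exists_bound_of_continuousOn hf.continuousOn
  exact Measure.integrableOn_of_bounded (hausdorffMeasure_hull_lt_top he).ne
    hf.aestronglyMeasurable
    ((ae_restrict_mem (isCompact_hull e).isClosed.measurableSet).mono fun x hx => hC x hx)

theorem edgeTrace_add (u v : M.PVector) (e : Finset Plane) (x : Plane) (i : Fin 2) :
    M.edgeTrace (u + v) e x i = M.edgeTrace u e x i + M.edgeTrace v e x i := by
  unfold edgeTrace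
  rw [← add_div, ← Finset.sum_add_distrib]
  congr 1
  refine Finset.sum_congr rfl fun t _ => ?_
  split_ifs <;> simp

theorem edgeTrace_smul (a : ℝ) (v : M.PVector) (e : Finset Plane) (x : Plane) (i : Fin 2) :
    M.edgeTrace (a • v) e x i = a * M.edgeTrace v e x i := by
  unfold edgeTrace
  rw [← mul_div_assoc, Finset.mul_sum]
  congr 1
  refine Finset.sum_congr rfl fun t _ => ?_
  split_ifs <;> simp

/-- The tangential trace on an edge. -/
def tangentialTrace (v : M.PVector) (e : Finset Plane) (x : Plane) : ℝ :=
  cross (M.edgeTrace v e x) (edgeNormal e)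

theorem tangentialTrace_add (u v : M.PVector) (e : Finset Plane) (x : Plane) :
    M.tangentialTrace (u + v) e x = M.tangentialTrace u e x + M.tangentialTrace v e x := by
  unfold tangentialTrace
  rw [← cross_add]
  congr 1
  ext i
  exact M.edgeTrace_add u v e x i

theorem tangentialTrace_smul (a : ℝ) (v : M.PVector) (e : Finset Plane) (x : Plane) :
    M.tangentialTrace (a • v) e x = a * M.tangentialTrace v e x := by
  unfold tangentialTrace
  rw [← cross_smul]
  congr 1
  ext i
  exact M.edgeTrace_smul a v e x i

theorem continuous_tangentialTrace (v : M.PVector) (e : Finset Plane) :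
    Continuous (M.tangentialTrace v e) := by
  classical
  have h : ∀ i, Continuous fun x => M.edgeTrace v e x i := by
    intro i
    unfold edgeTrace
    refine Continuous.div_const (continuous_finsetSum _ fun t _ => ?_) _
    split_ifs
    · exact continuous_evalAt _
    · exact continuous_const
  unfold tangentialTrace cross
  exact ((h 0).mul continuous_const).sub ((h 1).mul continuous_const)

theorem sheetIp_eq (u v : M.PVector) : M.sheetIp u v = ∑ e ∈ M.sheetEdges,
    ∫ x in hull e, M.tangentialTrace u e x * M.tangentialTrace v e x
      ∂(Measure.hausdorffMeasure 1) := rfl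

theorem sheetIp_comm (u v : M.PVector) : M.sheetIp u v = M.sheetIp v u := by
  simp only [sheetIp_eq, mul_comm]

theorem sheetIp_add_left (u u' v : M.PVector) :
    M.sheetIp (u + u') v = M.sheetIp u v + M.sheetIp u' v := by
  rw [sheetIp_eq, sheetIp_eq, sheetIp_eq, ← Finset.sum_add_distrib]
  refine Finset.sum_congr rfl fun e he => ?_
  obtain ⟨t, -, -, hc⟩ := M.exists_of_mem_sheetEdges he
  rw [← integral_add]
  · simp only [tangentialTrace_add, add_mul]
  · exact integrableOn_hull hc
      ((M.continuous_tangentialTrace u e).mul (M.continuous_tangentialTrace v e))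
  · exact integrableOn_hull hc
      ((M.continuous_tangentialTrace u' e).mul (M.continuous_tangentialTrace v e))

theorem sheetIp_smul_left (a : ℝ) (u v : M.PVector) :
    M.sheetIp (a • u) v = a * M.sheetIp u v := by
  rw [sheetIp_eq, sheetIp_eq, Finset.mul_sum]
  refine Finset.sum_congr rfl fun e _ => ?_
  rw [← integral_const_mul]
  simp only [tangentialTrace_smul, mul_assoc]

/-- The inner product of the tangential traces on the sheet. -/
def sheetForm : LinearMap.BilinForm ℝ M.PVector :=
  LinearMap.mk₂ ℝ M.sheetIp M.sheetIp_add_left M.sheetIp_smul_left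
    (fun u v v' => by
      rw [sheetIp_comm, sheetIp_add_left, M.sheetIp_comm v, M.sheetIp_comm v'])
    (fun a u v => by rw [sheetIp_comm, sheetIp_smul_left, M.sheetIp_comm v, smul_eq_mul])

theorem sheetForm_apply (u v : M.PVector) : M.sheetForm u v = M.sheetIp u v := rfl

theorem sheetForm_nonneg (u : M.PVector) : 0 ≤ M.sheetForm u u :=
  Finset.sum_nonneg fun _ _ => integral_nonneg fun _ => mul_self_nonneg _

theorem sheetNrm_sq (u : M.PVector) : M.sheetNrm u ^ 2 = M.sheetForm u u := by
  rw [sheetNrm, ← sheetForm_apply, Real.sq_sqrt (M.sheetForm_nonneg u)]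

/-! ### The finite element spaces as submodules -/

/-- The space `V_h⁰`. -/
def V₀Submodule (r : ℕ) : Submodule ℝ M.PVector where
  carrier := M.V₀ r
  add_mem' := by
    rintro u v ⟨⟨hu1, hu2⟩, hu3⟩ ⟨⟨hv1, hv2⟩, hv3⟩
    refine ⟨⟨fun t => nedelec_add (hu1 t) (hv1 t), ?_⟩, fun t e he hf x hx => ?_⟩
    · convert hu2.add hv2 using 1
      · ext x i
        exact M.fn_add (M.comp i u) (M.comp i v) x
      · ext x
        rw [← fn_add]
        exact congrFun (congrArg M.fn (M.curlLin.map_add u v)) x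
    · have := cross_add (fun i => evalAt x (u t i)) (fun i => evalAt x (v t i)) (edgeNormal e)
      rw [hu3 t e he hf x hx, hv3 t e he hf x hx, add_zero] at this
      simpa using this
  zero_mem' := by
    refine ⟨⟨fun t => ?_, ?_⟩, fun t e he hf x hx => ?_⟩
    · exact ⟨0, 0, (add_zero 0).symm, fun i => Submodule.zero_mem _,
        fun i => Submodule.zero_mem _, by simp⟩
    · have h1 : M.fnV 0 = fun _ _ => 0 := by
        ext x i
        simp [fnV, fn]
      have h2 : M.fn (M.curl 0) = fun _ => 0 := by
        ext x
        simp [curl, fn]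
      rw [h1, h2]
      exact ⟨fun i => MemLp.zero', MemLp.zero', fun φ _ _ _ => by simp⟩
    · simp [cross]
  smul_mem' := by
    rintro a u ⟨⟨hu1, hu2⟩, hu3⟩
    refine ⟨⟨fun t => nedelec_smul a (hu1 t), ?_⟩, fun t e he hf x hx => ?_⟩
    · convert hu2.const_mul a using 1
      · ext x i
        exact M.fn_smul a (M.comp i u) x
      · ext x
        rw [← fn_smul]
        exact congrFun (congrArg M.fn (M.curlLin.map_smul a u)) x
    · have := cross_smul a (fun i => evalAt x (u t i)) (edgeNormal e)
      rw [hu3 t e he hf x hx, mul_zero] at this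
      simpa using this

/-- The space `U_h`, in `L²(Ω)`. -/
def USubmodule (r : ℕ) : Submodule ℝ (Lp ℝ 2 (volume.restrict Ω)) :=
  (Submodule.pi Set.univ fun _ : M.triangles =>
    MvPolynomial.restrictTotalDegree (Fin 2) ℝ (r - 1)).map M.toL2

theorem toL2_mem {r : ℕ} {u : M.PScalar} (hu : u ∈ M.U r) : M.toL2 u ∈ M.USubmodule r :=
  Submodule.mem_map_of_mem fun t _ => hu t

theorem curl_mem {r : ℕ} {v : M.PVector} (hv : v ∈ M.V r) : M.curl v ∈ M.U r := fun t =>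
  Submodule.sub_mem _ (pderiv_nedelec_mem (hv.1 t) 1 0) (pderiv_nedelec_mem (hv.1 t) 0 1)

end TriMesh

/-! ### Normals and pointwise bounds for traces. -/

theorem norm_edgeNormal {e : Finset Plane} (he : e.card = 2) : ‖edgeNormal e‖ = 1 := by
  classical
  obtain ⟨a, b, hab, rfl⟩ := Finset.card_eq_two.1 he
  refine (Classical.epsilon_spec
    (p := fun n : Plane => ‖n‖ = 1 ∧ ∀ x ∈ ({a, b} : Finset Plane), ∀ y ∈ ({a, b} : Finset Plane),
      inner ℝ n (y - x) = 0) ?_).1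
  set w := b - a with hw
  have hw0 : ‖w‖ ≠ 0 := by rw [norm_ne_zero_iff, hw, sub_ne_zero]; exact hab.symm
  -- The edge vector rotated by a right angle, normalised below; its existence gives the chosen
  -- normal its defining properties.
  set z : Plane := !₂[-w 1, w 0] with hz
  have hzn : ‖z‖ = ‖w‖ := by
    rw [EuclideanSpace.norm_eq, EuclideanSpace.norm_eq]
    simp [hz, Fin.sum_univ_two, add_comm]
  have hzw : inner ℝ z (b - a) = 0 := by
    rw [← hw]
    simp [hz, PiLp.inner_apply, Fin.sum_univ_two]
    ring
  have hzw' : inner ℝ z (a - b) = 0 := by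
    rw [← neg_sub, inner_neg_right, hzw, neg_zero]
  refine ⟨‖w‖⁻¹ • z, ?_, ?_⟩
  · rw [norm_smul, norm_inv, norm_norm, hzn, inv_mul_cancel₀ hw0]
  · intro x hx y hy
    simp only [Finset.mem_insert, Finset.mem_singleton] at hx hy
    rw [real_inner_smul_left]
    rcases hx with rfl | rfl <;> rcases hy with rfl | rfl <;> simp [hzw, hzw']

theorem cross_sq_le {n : Plane} (hn : ‖n‖ = 1) (a : Fin 2 → ℝ) :
    cross a n ^ 2 ≤ a 0 ^ 2 + a 1 ^ 2 := by
  have h1 : n 0 ^ 2 + n 1 ^ 2 = 1 := by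
    have := EuclideanSpace.norm_sq_eq n
    rw [hn] at this
    simpa [Fin.sum_univ_two] using this.symm
  unfold cross
  have : (a 0 * n 1 - a 1 * n 0) ^ 2 + (a 0 * n 0 + a 1 * n 1) ^ 2
      = (a 0 ^ 2 + a 1 ^ 2) * (n 0 ^ 2 + n 1 ^ 2) := by ring
  rw [h1, mul_one] at this
  nlinarith [sq_nonneg (a 0 * n 0 + a 1 * n 1)]

/-- Cauchy–Schwarz gives the bound even with the factor 1/card, which is dropped; it is applied to
the mean of the traces from the triangles at an edge. -/
theorem sq_mean_le {ι : Type*} (s : Finset ι) (q : ι → ℝ) :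
    ((∑ i ∈ s, q i) / s.card) ^ 2 ≤ ∑ i ∈ s, q i ^ 2 := by
  have h0 : 0 ≤ ∑ i ∈ s, q i ^ 2 := Finset.sum_nonneg fun _ _ => sq_nonneg _
  rcases s.eq_empty_or_nonempty with rfl | hs
  · simp
  have h1 : (1 : ℝ) ≤ s.card := by exact_mod_cast hs.card_pos
  rw [div_pow, div_le_iff₀ (by positivity)]
  refine (sq_sum_le_card_mul_sum_sq (s := s) (f := q)).trans ?_
  rw [mul_comm]
  gcongr
  nlinarith

namespace TriMesh

variable {Ω Γ : Set Plane} (M : TriMesh Ω Γ)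

/-! ### Geometry of the triangles -/

/-- Distinct triangles share at most two vertices, so by conformity they meet in a set whose affine
span is not the plane, and such a set has empty interior. -/
theorem disjoint_interior {s t : Finset Plane} (hs : s ∈ M.triangles) (ht : t ∈ M.triangles)
    (hst : s ≠ t) : Disjoint (interior (hull s)) (interior (hull t)) := by
  classical
  rw [Set.disjoint_iff_inter_eq_empty, ← interior_inter, M.conforming s hs t ht]
  by_contra hne
  rw [← ne_eq, ← Set.nonempty_iff_ne_empty, interior_convexHull_nonempty_iff_affineSpan_eq_top]
    at hne
  obtain ⟨v, hvs, hvt⟩ : ∃ v ∈ s, v ∉ t := by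
    by_contra! hsub
    exact hst (Finset.eq_of_subset_of_card_le hsub (by rw [M.card_eq s hs, M.card_eq t ht]))
  have hsub : (s : Set Plane) ∩ t ⊆ (s.erase v : Finset Plane) := by
    rintro x ⟨hx1, hx2⟩
    exact Finset.mem_coe.2 (Finset.mem_erase.2 ⟨fun h => hvt (h ▸ hx2), hx1⟩)
  have htop : affineSpan ℝ ((s.erase v : Finset Plane) : Set Plane) = ⊤ :=
    top_le_iff.1 (hne ▸ affineSpan_mono ℝ hsub)
  have hcard : (s.erase v).card = 1 + 1 := by
    rw [Finset.card_erase_of_mem hvs, M.card_eq s hs]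
  have h1 := finrank_vectorSpan_image_finset_le ℝ (id : Plane → Plane) (s.erase v) hcard
  rw [Finset.image_id, ← direction_affineSpan, htop, AffineSubspace.direction_top, finrank_top,
    finrank_euclideanSpace_fin] at h1
  omega

theorem fn_of_mem (u : M.PScalar) {t : M.triangles} {x : Plane}
    (hx : x ∈ interior (hull (t : Finset Plane))) : M.fn u x = evalAt x (u t) := by
  unfold fn
  rw [Finset.sum_eq_single t, Set.indicator_of_mem hx]
  · intro s _ hst
    refine Set.indicator_of_notMem (fun hxs => ?_) _
    exact Set.disjoint_left.1 (M.disjoint_interior s.2 t.2 (fun h => hst (Subtype.ext h))) hxs hx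
  · exact fun h => (h (Finset.mem_univ t)).elim

theorem fn_mul_fn (u v : M.PScalar) (x : Plane) : M.fn u x * M.fn v x =
    ∑ t : M.triangles, (interior (hull (t : Finset Plane))).indicator
      (fun y => evalAt y (u t) * evalAt y (v t)) x := by
  by_cases h : ∃ t : M.triangles, x ∈ interior (hull (t : Finset Plane))
  · obtain ⟨t, ht⟩ := h
    rw [M.fn_of_mem u ht, M.fn_of_mem v ht, Finset.sum_eq_single t, Set.indicator_of_mem ht]
    · intro s _ hst
      refine Set.indicator_of_notMem (fun hxs => ?_) _
      exact Set.disjoint_left.1 (M.disjoint_interior s.2 t.2 (fun h => hst (Subtype.ext h))) hxs ht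
    · exact fun h => (h (Finset.mem_univ t)).elim
  · push Not at h
    unfold fn
    rw [Finset.sum_eq_zero fun t _ => Set.indicator_of_notMem (h t) _, zero_mul,
      Finset.sum_eq_zero fun t _ => Set.indicator_of_notMem (h t) _]

theorem integrableOn_interior (t : Finset Plane) (p q : Poly) :
    IntegrableOn (fun x => evalAt x p * evalAt x q) (interior (hull t)) := by
  have hb := (isCompact_hull t).isBounded.subset (_root_.interior_subset (s := hull t))
  have hm : MeasurableSet (interior (hull t)) := isOpen_interior.measurableSet
  exact (memLp_evalAt hb hm p).integrable_mul (memLp_evalAt hb hm q)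

theorem ip_fn (u v : M.PScalar) : ip Ω (M.fn u) (M.fn v) =
    ∑ t : M.triangles, ∫ x in interior (hull (t : Finset Plane)),
      evalAt x (u t) * evalAt x (v t) := by
  unfold ip
  simp_rw [M.fn_mul_fn]
  rw [integral_finsetSum]
  · refine Finset.sum_congr rfl fun t _ => ?_
    rw [integral_indicator isOpen_interior.measurableSet,
      Measure.restrict_restrict isOpen_interior.measurableSet,
      Set.inter_eq_left.2 (M.interior_subset t t.2)]
  · intro t _
    refine Integrable.restrict ?_
    rw [integrable_indicator_iff isOpen_interior.measurableSet]
    exact integrableOn_interior _ _ _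

/-- The mean square of a field on a triangle. -/
def localSq (v : M.PVector) (t : M.triangles) : ℝ :=
  ∑ i, ∫ x in interior (hull (t : Finset Plane)), evalAt x (v t i) ^ 2

theorem localSq_nonneg (v : M.PVector) (t : M.triangles) : 0 ≤ M.localSq v t :=
  Finset.sum_nonneg fun _ _ => integral_nonneg fun _ => sq_nonneg _

theorem sum_localSq (v : M.PVector) : ∑ t, M.localSq v t = nrmV Ω (M.fnV v) ^ 2 := by
  rw [nrmV_sq, fieldForm_eq_sum]
  unfold localSq
  rw [Finset.sum_comm]
  refine Finset.sum_congr rfl fun i _ => ?_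
  rw [inner_toL2, ip_fn]
  simp only [sq]
  rfl

theorem diam_le_h {t : Finset Plane} (ht : t ∈ M.triangles) : Metric.diam (hull t) ≤ M.h :=
  le_ciSup (f := fun t : M.triangles => Metric.diam (hull (t : Finset Plane)))
    (Set.finite_range _).bddAbove ⟨t, ht⟩

theorem dist_le_h {t : Finset Plane} (ht : t ∈ M.triangles) {x y : Plane} (hx : x ∈ hull t)
    (hy : y ∈ hull t) : dist x y ≤ M.h :=
  (Metric.dist_le_diam_of_mem (isCompact_hull t).isBounded hx hy).trans (M.diam_le_h ht)

theorem h_pos {t : Finset Plane} (ht : t ∈ M.triangles) : 0 < M.h := by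
  obtain ⟨a, ha, b, hb, hab⟩ := Finset.one_lt_card.1 (by rw [M.card_eq t ht]; norm_num : 1 < t.card)
  exact (dist_pos.2 hab).trans_le
    (M.dist_le_h ht (subset_convexHull ℝ _ ha) (subset_convexHull ℝ _ hb))

/-! ### The inverse estimate and the trace inequality -/

/-- Pointwise bounds for a field and its derivatives on a triangle. -/
theorem exists_local_bounds (r : ℕ) {κ : ℝ} (hκ : 0 < κ) :
    ∃ C : ℝ, 0 < C ∧ ∀ (Ω Γ : Set Plane) (M : TriMesh Ω Γ), M.QuasiUniform κ →
      ∀ v ∈ M.V r, ∀ t : M.triangles, ∀ x ∈ hull (t : Finset Plane),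
        evalAt x (v t 0) ^ 2 + evalAt x (v t 1) ^ 2 ≤ C * (M.h ^ 2)⁻¹ * M.localSq v t ∧
        evalAt x (M.curl v t) ^ 2 ≤ C * (M.h ^ 4)⁻¹ * M.localSq v t := by
  obtain ⟨C, hC0, hC⟩ := exists_sq_evalAt_le_scaled r hκ
  refine ⟨2 * C, by positivity, fun Ω Γ M hM v hv t x hx => ?_⟩
  have hh := M.h_pos t.2
  obtain ⟨c, hc⟩ := hM t t.2
  have hcm : c ∈ hull (t : Finset Plane) := hc (Metric.mem_ball_self (by positivity))
  -- The centre of the inscribed disc lies in the triangle, whose diameter is at most h.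
  have hxc : x ∈ Metric.closedBall c M.h := M.dist_le_h t.2 hx hcm
  have hle : ∀ i, ∫ y in Metric.ball c (M.h / κ), evalAt y (v t i) ^ 2
      ≤ ∫ y in interior (hull (t : Finset Plane)), evalAt y (v t i) ^ 2 := fun i => by
    refine setIntegral_mono_set ?_ (ae_of_all _ fun _ => sq_nonneg _)
      (interior_maximal hc Metric.isOpen_ball).eventuallyLE
    simpa only [sq] using integrableOn_interior (t : Finset Plane) (v t i) (v t i)
  have key := fun i => hC _ (nedelec_mem (hv.1 t) i) c M.h hh x hxc
  have hls : M.localSq v t = (∫ y in interior (hull (t : Finset Plane)), evalAt y (v t 0) ^ 2)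
    + ∫ y in interior (hull (t : Finset Plane)), evalAt y (v t 1) ^ 2 := Fin.sum_univ_two _
  have hnn : 0 ≤ C * (M.h ^ 2)⁻¹ * M.localSq v t := by
    have := M.localSq_nonneg v t
    positivity
  constructor
  · have h0 := (key 0).1.trans (mul_le_mul_of_nonneg_left (hle 0) (by positivity))
    have h1 := (key 1).1.trans (mul_le_mul_of_nonneg_left (hle 1) (by positivity))
    rw [hls] at hnn ⊢
    linarith
  · have h0 := ((key 0).2 1).trans (mul_le_mul_of_nonneg_left (hle 0) (by positivity))
    have h1 := ((key 1).2 0).trans (mul_le_mul_of_nonneg_left (hle 1) (by positivity))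
    have e : evalAt x (M.curl v t) = evalAt x (MvPolynomial.pderiv 0 (v t 1))
        - evalAt x (MvPolynomial.pderiv 1 (v t 0)) := evalAt_sub _ _ _
    rw [e, hls]
    linarith [sq_nonneg (evalAt x (MvPolynomial.pderiv 0 (v t 1))
        + evalAt x (MvPolynomial.pderiv 1 (v t 0)))]

/-- On each triangle the squared curl is at most C h⁻⁴ times the local mean square, and the area is
at most h² times that of the unit disc. Summation over triangles gives the factor h⁻². -/
theorem exists_inverseEstimate (r : ℕ) {κ : ℝ} (hκ : 0 < κ) :
    ∃ Cin : ℝ, 0 < Cin ∧ ∀ (Ω Γ : Set Plane) (M : TriMesh Ω Γ), M.QuasiUniform κ →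
      M.InverseEstimate r Cin := by
  obtain ⟨C, hC0, hC⟩ := exists_local_bounds r hκ
  set w := volume.real (Metric.closedBall (0 : Plane) 1) with hw
  have hw0 : 0 ≤ w := measureReal_nonneg
  refine ⟨√(C * w + 1), by positivity, fun Ω Γ M hM v hv => ?_⟩
  have hb := hC Ω Γ M hM v hv
  -- Without triangles h is a supremum over the empty set, hence 0, and both sides vanish.
  rcases isEmpty_or_nonempty M.triangles with hemp | ⟨⟨t0⟩⟩
  · have : nrm Ω (M.fn (M.curl v)) = 0 := by
      rw [nrm, ip_fn]
      simp
    have h0 : M.h = 0 := by unfold h; exact Real.iSup_of_isEmpty _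
    rw [this, h0]
    simp
  have hh := M.h_pos t0.2
  refine le_of_sq_le_sq ?_ (by unfold nrmV; positivity)
  rw [mul_pow, mul_pow, Real.sq_sqrt (by positivity), ← sum_localSq, ← norm_toL2_sq,
    ← real_inner_self_eq_norm_sq, inner_toL2, ip_fn, Finset.mul_sum]
  refine Finset.sum_le_sum fun t _ => ?_
  have hls := M.localSq_nonneg v t
  obtain ⟨x0, hx0⟩ : (hull (t : Finset Plane)).Nonempty := by
    obtain ⟨a, ha⟩ := Finset.card_pos.1 (by rw [M.card_eq t t.2]; norm_num : 0 < (t : Finset Plane).card)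
    exact ⟨a, subset_convexHull ℝ _ ha⟩
  have hvol : volume.real (interior (hull (t : Finset Plane))) ≤ M.h ^ 2 * w := by
    have h1 : interior (hull (t : Finset Plane)) ⊆ Metric.closedBall x0 M.h := fun y hy =>
      M.dist_le_h t.2 (_root_.interior_subset hy) hx0
    refine (measureReal_mono h1 (by exact (isCompact_closedBall _ _).measure_lt_top.ne)).trans_eq ?_
    rw [Measure.addHaar_real_closedBall' _ _ hh.le, finrank_euclideanSpace_fin]
  have h2 : ‖∫ x in interior (hull (t : Finset Plane)), evalAt x (M.curl v t) * evalAt x (M.curl v t)‖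
      ≤ C * (M.h ^ 4)⁻¹ * M.localSq v t * volume.real (interior (hull (t : Finset Plane))) := by
    refine norm_setIntegral_le_of_norm_le_const ?_ fun x hx => ?_
    · exact ((isCompact_hull _).isBounded.subset _root_.interior_subset).measure_lt_top
    · rw [← sq, Real.norm_of_nonneg (sq_nonneg _)]
      exact (hb t x (_root_.interior_subset hx)).2
  calc _ ≤ _ := (Real.le_norm_self _).trans h2
    _ ≤ C * (M.h ^ 4)⁻¹ * M.localSq v t * (M.h ^ 2 * w) := by gcongr
    _ = C * w * M.h⁻¹ ^ 2 * M.localSq v t := by field_simp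
    _ ≤ _ := by gcongr; linarith

/-- An edge has length at most h, so the pointwise bound C h⁻² integrates to C h⁻¹. Each triangle is
counted once for each of its sheet edges, at most three times; hence 3C. -/
theorem exists_traceInequality (r : ℕ) {κ : ℝ} (hκ : 0 < κ) :
    ∃ Ctr : ℝ, 0 < Ctr ∧ ∀ (Ω Γ : Set Plane) (M : TriMesh Ω Γ), M.QuasiUniform κ →
      M.TraceInequality r Ctr := by
  classical
  obtain ⟨C, hC0, hC⟩ := exists_local_bounds r hκ
  refine ⟨√(3 * C), by positivity, fun Ω Γ M hM v hv => ?_⟩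
  have hb := hC Ω Γ M hM v hv
  rcases isEmpty_or_nonempty M.triangles with hemp | ⟨⟨t0⟩⟩
  · have : M.sheetNrm v = 0 := by
      rw [sheetNrm, sheetIp_eq, Finset.sum_eq_zero, Real.sqrt_zero]
      intro e he
      obtain ⟨t, ht, -⟩ := M.exists_of_mem_sheetEdges he
      exact (hemp.false ⟨t, ht⟩).elim
    have h0 : M.h = 0 := by unfold h; exact Real.iSup_of_isEmpty _
    rw [this, h0]
    simp
  have hh := M.h_pos t0.2
  refine le_of_sq_le_sq ?_ (by unfold nrmV; positivity)
  rw [mul_pow, mul_pow, Real.sq_sqrt (by positivity), inv_pow, Real.sq_sqrt hh.le, ← sum_localSq,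
    sheetNrm_sq, sheetForm_apply, sheetIp_eq]
  have hedge : ∀ e ∈ M.sheetEdges, ∫ x in hull e, M.tangentialTrace v e x * M.tangentialTrace v e x
      ∂(Measure.hausdorffMeasure 1) ≤
      ∑ t : M.triangles, if e ⊆ (t : Finset Plane) then C * M.h⁻¹ * M.localSq v t else 0 := by
    intro e he
    obtain ⟨s, hs, hes, hcard⟩ := M.exists_of_mem_sheetEdges he
    have hmeas : (Measure.hausdorffMeasure 1 : Measure Plane).real (hull e) ≤ M.h := by
      obtain ⟨a, b, -, rfl⟩ := Finset.card_eq_two.1 hcard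
      rw [hull_pair, measureReal_def, hausdorffMeasure_segment, ← dist_edist]
      exact M.dist_le_h hs (subset_convexHull ℝ _ (hes (by simp)))
        (subset_convexHull ℝ _ (hes (by simp)))
    have hpt : ∀ x ∈ hull e, M.tangentialTrace v e x * M.tangentialTrace v e x ≤
        ∑ t : M.triangles,
          if e ⊆ (t : Finset Plane) then C * (M.h ^ 2)⁻¹ * M.localSq v t else 0 := by
      intro x hx
      set F := Finset.univ.filter fun t : M.triangles => e ⊆ (t : Finset Plane) with hF
      have hFc : (M.triangles.filter fun t => e ⊆ t).card = F.card := by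
        rw [← Finset.card_map (Function.Embedding.subtype _)]
        congr 1
        ext t
        simp [hF, and_comm]
      have e1 : M.tangentialTrace v e x
          = (∑ t ∈ F, cross (fun i => evalAt x (v t i)) (edgeNormal e)) / F.card := by
        unfold tangentialTrace cross edgeTrace
        rw [← Finset.sum_filter, ← Finset.sum_filter, Finset.sum_sub_distrib, ← Finset.sum_mul,
          ← Finset.sum_mul, sub_div, ← hFc, hF]
        ring
      rw [← sq, e1, ← Finset.sum_filter]
      refine (sq_mean_le _ _).trans (Finset.sum_le_sum fun t ht => ?_)
      refine (cross_sq_le (norm_edgeNormal hcard) _).trans (hb t x ?_).1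
      exact convexHull_mono (Finset.coe_subset.2 (Finset.mem_filter.1 ht).2) hx
    set B := ∑ t : M.triangles,
          if e ⊆ (t : Finset Plane) then C * (M.h ^ 2)⁻¹ * M.localSq v t else 0 with hB
    have hB0 : 0 ≤ B := Finset.sum_nonneg fun t _ => by
      have := M.localSq_nonneg v t
      split_ifs <;> positivity
    have h2 : ‖∫ x in hull e, M.tangentialTrace v e x * M.tangentialTrace v e x
        ∂(Measure.hausdorffMeasure 1)‖ ≤ B * (Measure.hausdorffMeasure 1).real (hull e) := by
      refine norm_setIntegral_le_of_norm_le_const (hausdorffMeasure_hull_lt_top hcard)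
        fun x hx => ?_
      rw [Real.norm_of_nonneg (mul_self_nonneg _)]
      exact hpt x hx
    calc _ ≤ _ := (Real.le_norm_self _).trans h2
      _ ≤ B * M.h := by gcongr
      _ = _ := by
        rw [hB, Finset.sum_mul]
        refine Finset.sum_congr rfl fun t _ => ?_
        split_ifs
        · field_simp
        · simp
  refine (Finset.sum_le_sum hedge).trans ?_
  rw [Finset.sum_comm, Finset.mul_sum]
  refine Finset.sum_le_sum fun t _ => ?_
  rw [← Finset.sum_filter, Finset.sum_const, nsmul_eq_mul]
  have hls := M.localSq_nonneg v t
  have hc : (M.sheetEdges.filter fun e => e ⊆ (t : Finset Plane)).card ≤ 3 := by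
    have : (M.sheetEdges.filter fun e => e ⊆ (t : Finset Plane)) ⊆
        (t : Finset Plane).powersetCard 2 := by
      intro e he
      rw [Finset.mem_filter] at he
      obtain ⟨-, -, -, hcard⟩ := M.exists_of_mem_sheetEdges he.1
      exact Finset.mem_powersetCard.2 ⟨he.2, hcard⟩
    refine (Finset.card_le_card this).trans_eq ?_
    rw [Finset.card_powersetCard, M.card_eq t t.2]
    rfl
  have hc' : ((M.sheetEdges.filter fun e => e ⊆ (t : Finset Plane)).card : ℝ) ≤ 3 := by
    exact_mod_cast hc
  calc _ ≤ 3 * (C * M.h⁻¹ * M.localSq v t) := by gcongr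
    _ = _ := by ring

end TriMesh

/-! ### The finite element scheme as an instance of the abstract one. -/

theorem sum_Icc_one_eq_sum_range (f : ℤ → ℝ) (m : ℕ) :
    ∑ n ∈ Finset.Icc (1 : ℤ) m, f n = ∑ n ∈ Finset.range m, f (n + 1) := by
  have : Finset.Icc (1 : ℤ) m = (Finset.range m).map
      ⟨fun n : ℕ => (n : ℤ) + 1, fun a b h => by simpa using h⟩ := by
    ext x
    simp only [Finset.mem_Icc, Finset.mem_map, Finset.mem_range]
    constructor
    · rintro ⟨h1, h2⟩
      exact ⟨(x - 1).toNat, by omega, show ((x - 1).toNat : ℤ) + 1 = x by omega⟩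
    · rintro ⟨a, h1, rfl⟩
      change 1 ≤ (a : ℤ) + 1 ∧ (a : ℤ) + 1 ≤ m
      omega
  rw [this, Finset.sum_map]
  rfl

theorem norm_toLp_sq_eq_nrm {Ω : Set Plane} {f : Plane → ℝ} (hf : MemLp f 2 (volume.restrict Ω)) :
    ‖hf.toLp f‖ ^ 2 = nrm Ω f ^ 2 := by
  rw [← real_inner_self_eq_norm_sq, inner_toLp, nrm, ip, Real.sq_sqrt]
  exact integral_nonneg fun x => mul_self_nonneg _

namespace TriMesh

variable {Ω Γ : Set Plane} {M : TriMesh Ω Γ}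

theorem norm_curlL2_sq_le {r : ℕ} {C : ℝ} (hM : M.InverseEstimate r C) {φ : M.PVector}
    (hφ : φ ∈ M.V r) : ‖M.curlL2 φ‖ ^ 2 ≤ (C * M.h⁻¹) ^ 2 * M.fieldForm φ φ := by
  rw [curlL2_apply, norm_toL2_sq, ← nrmV_sq, ← mul_pow]
  exact pow_le_pow_left₀ (Real.sqrt_nonneg _) (hM φ hφ) 2

theorem sheetForm_le {r : ℕ} {C : ℝ} (hM : M.TraceInequality r C) {φ : M.PVector}
    (hφ : φ ∈ M.V r) : M.sheetForm φ φ ≤ (C * (√M.h)⁻¹) ^ 2 * M.fieldForm φ φ := by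
  rw [← sheetNrm_sq, ← nrmV_sq, ← mul_pow]
  exact pow_le_pow_left₀ (Real.sqrt_nonneg _) (hM φ hφ) 2

theorem energy_eq_eng (p : Params) (τ : ℝ) (E : ℤ → M.PVector) (H : ℤ → M.PScalar) (m : ℕ) :
    M.energy p τ E H m = LeapfrogSystem.eng p τ M.fieldForm M.sheetForm M.curlL2
      (fun n => E n) (fun n => M.toL2 (H n)) m := by
  unfold energy LeapfrogSystem.eng
  simp only [nrmV_sq, sheetNrm_sq, curlL2_apply, norm_toL2_sq, map_smul, LinearMap.smul_apply,
    smul_eq_mul, Nat.cast_add, Nat.cast_one]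
  ring

/-- The source as a sequence in `L²(Ω)`, set to zero after the final time. -/
def sourceSeq (Ks : ℝ → Plane → ℝ) (τ : ℝ) (N : ℕ)
    (hK : ∀ n : ℕ, n ≤ N → MemLp (Ks (n * τ)) 2 (volume.restrict Ω)) (n : ℕ) :
    Lp ℝ 2 (volume.restrict Ω) :=
  if hn : n ≤ N then (hK n hn).toLp _ else 0

/-- The field E stays a piecewise polynomial, because traces on the sheet are not defined on L²
classes. Curls, H and the sources live in L²(Ω), since the sources need not be polynomial. -/
theorem IsLeapfrog.leapfrogSystem {p : Params} {r N : ℕ} {τ : ℝ} {Ks : ℝ → Plane → ℝ}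
    {E : ℤ → M.PVector} {H : ℤ → M.PScalar} (hs : M.IsLeapfrog p r N τ Ks E H)
    (hK : ∀ n : ℕ, n ≤ N → MemLp (Ks (n * τ)) 2 (volume.restrict Ω)) {m : ℕ} (hm : m + 1 ≤ N) :
    LeapfrogSystem p τ m M.fieldForm M.sheetForm M.curlL2 (M.V₀Submodule r) (M.USubmodule r)
      (fun n => E n) (fun n => M.toL2 (H n)) (sourceSeq Ks τ N hK) where
  A_symm := M.fieldForm_symm
  A_nonneg := M.fieldForm_nonneg
  S_symm := M.sheetIp_comm
  S_nonneg := M.sheetForm_nonneg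
  map_mem φ hφ := M.toL2_mem (M.curl_mem hφ.1)
  e_mem n hn := hs.E_mem n (by omega) (by omega)
  h_mem n hn := M.toL2_mem (hs.H_mem n (by omega) (by omega))
  e_step n hn φ hφ := by
    -- The abstract step n is the equation at time n + 1, so the times 1, …, m are used. The
    -- equations at time 0 and the values E^{-1}, H^{-1/2} play no part.
    have h := hs.E_step (n + 1) (by omega) (by omega) φ hφ
    have e1 : (n : ℤ) + 1 + 1 = ((n + 2 : ℕ) : ℤ) := by push_cast; ring
    have e2 : (n : ℤ) + 1 - 1 = n := by ring
    have e3 : (n : ℤ) + 1 = ((n + 1 : ℕ) : ℤ) := by push_cast; ring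
    rw [e1, e2, e3, ← fieldForm_apply, ← fieldForm_apply, ← inner_toL2, ← inner_toL2,
      map_smul, map_smul, map_smul, LinearMap.smul_apply, LinearMap.smul_apply,
      real_inner_smul_left, map_add M.toL2, smul_eq_mul, smul_eq_mul, Int.cast_natCast] at h
    have hk : ip Ω (Ks ((n + 1 : ℕ) * τ)) (M.fn (M.curl φ))
        = inner ℝ (sourceSeq Ks τ N hK (n + 1)) (M.curlL2 φ) := by
      rw [sourceSeq, dif_pos (by omega)]
      exact (inner_toLp _ (M.memLp_fn _)).symm
    rw [hk] at h
    exact h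
  h_step n hn ψ hψ := by
    obtain ⟨u, hu, rfl⟩ := hψ
    have h := hs.H_step (n + 1) (by omega) (by omega) u fun t => hu t (Set.mem_univ t)
    have e2 : (n : ℤ) + 1 - 1 = n := by ring
    have e3 : (n : ℤ) + 1 = ((n + 1 : ℕ) : ℤ) := by push_cast; ring
    rw [e2, e3, ← inner_toL2, ← inner_toL2, map_smul, map_sub, real_inner_smul_left,
      Int.cast_natCast] at h
    have hk : ip Ω (Ks ((n + 1 : ℕ) * τ)) (M.fn u)
        = inner ℝ (sourceSeq Ks τ N hK (n + 1)) (M.toL2 u) := by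
      rw [sourceSeq, dif_pos (by omega)]
      exact (inner_toLp _ (M.memLp_fn _)).symm
    rw [hk] at h
    exact h

/-- The largest source index is m + 1 ≤ N, so the extension of the source by zero is never seen. -/
theorem data_eq (p : Params) {τ : ℝ} {N : ℕ} {Ks : ℝ → Plane → ℝ} (E : ℤ → M.PVector)
    (H : ℤ → M.PScalar) (hK : ∀ n : ℕ, n ≤ N → MemLp (Ks (n * τ)) 2 (volume.restrict Ω))
    {m : ℕ} (hm : m + 1 ≤ N) :
    LeapfrogSystem.data p τ M.fieldForm M.sheetForm M.curlL2 (fun n => E n)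
      (fun n => M.toL2 (H n)) (sourceSeq Ks τ N hK) m =
    M.energy p τ E H 0 + nrm Ω (Ks 0) ^ 2 + nrm Ω (Ks τ) ^ 2
      + τ * ∑ n ∈ Finset.Icc (1 : ℤ) m, (nrm Ω (Ks (n * τ)) ^ 2
        + nrm Ω ((2 * τ)⁻¹ • (Ks ((n + 1) * τ) - Ks ((n - 1) * τ))) ^ 2) := by
  have hn : ∀ n, n ≤ N → ‖sourceSeq Ks τ N hK n‖ ^ 2 = nrm Ω (Ks (n * τ)) ^ 2 := by
    intro n hn
    rw [sourceSeq, dif_pos hn, norm_toLp_sq_eq_nrm]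
  have h0 := hn 0 (by omega)
  have h1 := hn 1 (by omega)
  rw [Nat.cast_zero, zero_mul] at h0
  rw [Nat.cast_one, one_mul] at h1
  unfold LeapfrogSystem.data
  rw [h0, h1, sum_Icc_one_eq_sum_range, ← energy_eq_eng, Nat.cast_zero]
  congr 2
  refine Finset.sum_congr rfl fun n hnm => ?_
  rw [Finset.mem_range] at hnm
  rw [hn _ (by omega)]
  congr 1
  · have : (2 * τ)⁻¹ • (sourceSeq Ks τ N hK (n + 2) - sourceSeq Ks τ N hK n)
        = (((hK (n + 2) (by omega)).sub (hK n (by omega))).const_smul (2 * τ)⁻¹).toLp _ := by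
      rw [sourceSeq, dif_pos (by omega), sourceSeq, dif_pos (by omega)]
      rfl
    rw [this, norm_toLp_sq_eq_nrm]
    push_cast
    rw [show (n : ℝ) + 1 + 1 = n + 2 by ring, show (n : ℝ) + 1 - 1 = n by ring]

end TriMesh

end Graphene

end

/-! ### The main theorem. -/

theorem theorem3p1 (p : Graphene.Params) (T : ℝ) (hT : 0 < T) (r : ℕ) (hr : 1 ≤ r)
    (Ω Γ : Set Graphene.Plane) (hΩ : IsOpen Ω) :
    -- constants in the inverse estimate and the trace inequality exist, uniformly in the mesh
    (∀ κ : ℝ, 0 < κ → ∃ Cin Ctr : ℝ, 0 < Cin ∧ 0 < Ctr ∧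
      ∀ M : Graphene.TriMesh Ω Γ, M.QuasiUniform κ →
        M.InverseEstimate r Cin ∧ M.TraceInequality r Ctr) ∧
    -- stability of the scheme, for any such constants
    (∀ Cin Ctr : ℝ, 0 < Cin → 0 < Ctr → ∃ Cstar : ℝ, 0 < Cstar ∧
      ∀ M : Graphene.TriMesh Ω Γ, M.InverseEstimate r Cin → M.TraceInequality r Ctr →
      ∀ (N : ℕ) (τ : ℝ), 0 < N → τ = T / N → Graphene.CFL p Cin Ctr M.h τ →
      ∀ Ks : ℝ → Graphene.Plane → ℝ,
        (∀ t ∈ Set.Icc 0 T, MeasureTheory.MemLp (Ks t) 2 (MeasureTheory.volume.restrict Ω)) →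
      ∀ (E : ℤ → M.PVector) (H : ℤ → M.PScalar), M.IsLeapfrog p r N τ Ks E H →
      ∀ m : ℤ, 1 ≤ m → m ≤ (N : ℤ) - 1 →
        M.energy p τ E H m ≤ Cstar * (M.energy p τ E H 0
          + Graphene.nrm Ω (Ks 0) ^ 2 + Graphene.nrm Ω (Ks τ) ^ 2
          + τ * ∑ n ∈ Finset.Icc 1 m, (Graphene.nrm Ω (Ks (n * τ)) ^ 2
            + Graphene.nrm Ω ((2 * τ)⁻¹ • (Ks ((n + 1) * τ) - Ks ((n - 1) * τ))) ^ 2))) := by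
  refine ⟨fun κ hκ => ?_, fun Cin Ctr hCin hCtr => ?_⟩
  · obtain ⟨Cin, h1, h2⟩ := Graphene.TriMesh.exists_inverseEstimate r hκ
    obtain ⟨Ctr, h3, h4⟩ := Graphene.TriMesh.exists_traceInequality r hκ
    exact ⟨Cin, Ctr, h1, h3, fun M hM => ⟨h2 Ω Γ M hM, h4 Ω Γ M hM⟩⟩
  · obtain ⟨C, hC, hbound⟩ := Graphene.LeapfrogSystem.exists_energy_bound p hT hCin hCtr
    refine ⟨C, hC, fun M hI hTr N τ hN hτ hcfl Ks hKs E H hs m hm1 hmN => ?_⟩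
    have hN' : (0 : ℝ) < N := by exact_mod_cast hN
    have hτ0 : 0 < τ := by rw [hτ]; positivity
    have hNτ : N * τ = T := by rw [hτ]; field_simp
    -- A positive τ below the restriction forces h > 0, so the degenerate value h = 0 is excluded.
    have hh : 0 < M.h := by
      have hCv : 0 < p.Cv := by
        have := p.ε₀_pos
        have := p.μ₀_pos
        unfold Graphene.Params.Cv
        positivity
      have h1 : 0 < M.h / (2 * Cin * p.Cv) := by
        refine hτ0.trans_le (hcfl.trans ?_)
        exact (min_le_right _ _).trans (min_le_left _ _)
      exact (div_pos_iff_of_pos_right (by positivity)).1 h1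
    have hK : ∀ n : ℕ, n ≤ N →
        MeasureTheory.MemLp (Ks (n * τ)) 2 (MeasureTheory.volume.restrict Ω) := by
      intro n hn
      have hn' : (n : ℝ) ≤ N := by exact_mod_cast hn
      refine hKs _ ⟨by positivity, ?_⟩
      rw [← hNτ]
      gcongr
    obtain ⟨m, rfl⟩ := Int.eq_ofNat_of_zero_le (by omega : 0 ≤ m)
    have hmN' : m + 1 ≤ N := by omega
    have hmT : m * τ ≤ T := by
      have : (m : ℝ) ≤ N := by exact_mod_cast (by omega : m ≤ N)
      rw [← hNτ]
      gcongr
    rw [← Graphene.TriMesh.data_eq p E H hK hmN', Graphene.TriMesh.energy_eq_eng]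
    -- The abstract bound is applied with m as the number of steps, so that the source sum ends at
    -- m.
    exact hbound _ _ τ M.h m _ _ _ (M.V₀Submodule r) (M.USubmodule r) _ _ _ hτ0 hh hmT hcfl
      (fun φ hφ => Graphene.TriMesh.norm_curlL2_sq_le hI hφ.1)
      (fun φ hφ => Graphene.TriMesh.sheetForm_le hTr hφ.1) (hs.leapfrogSystem hK hmN')
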